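/- Conventions. All lattices and posets are finite. An element of a poset is doubly irreducible if it has at most one lower cover and at most one upper cover, and reducible otherwise; $\mathrm{Irr}(P)$ and $\mathrm{Red}(P)$ denote the sets of doubly irreducible and of reducible elements of $P$ (in a finite lattice, reducible means join-reducible or meet-reducible). The nullity $\eta(P)$ is (edges) $-$ (vertices) $+$ (connected components) of the cover graph of $P$. A block is a lattice whose largest element is join-reducible and whose least element is meet-reducible (equivalently, a lattice that is the maximal block of some lattice). A lattice is a basic block if it has one element, or if it is a block such that $\mathrm{Irr}=\emptyset$ or the removal of any doubly irreducible element lowers the nullity by one. An element $x\in \mathrm{Irr}(P)$ is retractible if there are no $y,z\in\mathrm{Red}(P)$ with $y\prec x\prec z$, or there are $y,z\in \mathrm{Red}(P)$ with $y\prec x\prec z$ such that there is no other directed path (sequence of successive coverings) from $y$ to $z$ in $P$. A poset is a basic retract if no element having exactly one lower cover and exactly one upper cover is retractible. $B$ is the basic block associated to $P$ if, up to isomorphism, $B$ arises from $P$ by first removing retractible elements with exactly one lower and exactly one upper cover, one after the other, until a basic retract is reached, and then removing, one after the other, pendant vertices of the cover graph and such retractible elements formed in doing so, until neither kind is left. For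 disjoint lattices $L_1,L_2$ and $a<b$ in $L_1$ with $a\not\prec b$, the adjunct $L_1]_a^b L_2$ is $L_1\cup L_2$ ordered by the orders of $L_1$ and $L_2$ together with: for $x\in L_1$, $y\in L_2$, $x\le y$ iff $x\le a$, and $y\le x$ iff $b\le x$. **Theorem.** Let $B$ be a basic block of nullity $k$ with exactly $r$ reducible elements, which are pairwise comparable, where $2\le r\le 2k$, and let $n\ge |B|$. Then $B$ has a representation $B = C_0\,]_{a_1}^{b_1} C_1\,]_{a_2}^{b_2} C_2\cdots]_{a_k}^{b_k} C_k$ by nonempty chains in which $C_0$ is a maximal chain of $B$ containing all $a_i,b_i$. For any such representation, let the multiplicity of an adjunct pair be the number of indices $i$ for which $(a_i,b_i)$ equals this pair; let $m_1,\dots,m_m$ be the multiplicities of the $m\ge 0$ distinct adjunct pairs $(a,b)$ whose open interval $(a,b)$ is contained in $\mathrm{Irr}(B)$, and let $p_1,\dots,p_p$ be the multiplicities of the $p\ge 0$ distinct adjunct pairs $(a,b)$ whose open interval $(a,b)$ contains a reducible element. Put $l=r-m-1$. Then $l\ge 0$, $k=\sum_{j=1}^m m_j+\sum_{j=1}^p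 p_j$, $|B|=r+m+k$, and the number of isomorphism classes of blocks on $n$ elements that have nullity $k$ and exactly $r$ reducible elements, pairwise comparable, and whose associated basic block is $B$, equals $$\sum_{u}\left(\prod_{i=1}^{m}P_{u_i}^{m_i+1}\right)\left(\prod_{i=1}^{p}P_{u_{m+i}}^{p_i}\right),$$ where $u=(u_1,\dots,u_{m+p+l})$ ranges over the tuples of non-negative integers with $u_1+\cdots+u_{m+p+l}=n-r$, $u_i\ge m_i+1$ for $1\le i\le m$, and $u_{m+i}\ge p_i$ for $1\le i\le p$, and $P_s^t$ denotes the number of partitions of $s$ into exactly $t$ positive parts. -/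

import Mathlib

namespace RCLattice

section Posets

variable (P : Type*) [PartialOrder P]

/-- The doubly irreducible elements of a poset: at most one lower cover and at most one
upper cover. -/
def Irr : Set P :=
  {x | {y | y ⋖ x}.Subsingleton ∧ {y | x ⋖ y}.Subsingleton}

/-- The elements with exactly one lower cover and exactly one upper cover. -/
def IrrStar : Set P :=
  {x | (∃! y, y ⋖ x) ∧ (∃! y, x ⋖ y)}

/-- The reducible elements: the complement of the set of doubly irreducible elements. -/
def Red : Set P := (Irr P)ᶜ

/-- All reducible elements are pairwise comparable. -/
def IsRC : Prop := IsChain (· ≤ ·) (Red P)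

/-- The nullity of a finite poset, i.e. the number `edges - vertices + components` of its
cover graph. -/
noncomputable def nullity : ℤ :=
  ((SimpleGraph.hasse P).edgeSet.ncard : ℤ) - (Nat.card P : ℤ)
    + (Nat.card (SimpleGraph.hasse P).ConnectedComponent : ℤ)

variable {P}

/-- A doubly irreducible element `x` is retractible if it does not lie in a covering chain
`y ⋖ x ⋖ z` with `y`, `z` reducible, or it lies in such a chain and `y ⋖ x ⋖ z` is the only
directed path (sequence of successive coverings) from `y` to `z`. -/
def IsRetractible (x : P) : Prop :=
  x ∈ Irr P ∧
    ((¬ ∃ y ∈ Red P, ∃ z ∈ Red P, y ⋖ x ∧ x ⋖ z) ∨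
      ∃ y ∈ Red P, ∃ z ∈ Red P, y ⋖ x ∧ x ⋖ z ∧
        ∀ w : List P, w.IsChain (· ⋖ ·) → w.head? = some y → w.getLast? = some z →
          w = [y, x, z])

/-- A vertex of degree one in the cover graph. -/
def IsPendant (x : P) : Prop := ((SimpleGraph.hasse P).neighborSet x).ncard = 1

variable (P)

/-- A poset is a basic retract if no element with exactly one lower and exactly one upper cover
is retractible. -/
def IsBasicRetract : Prop := ∀ x ∈ IrrStar P, ¬ IsRetractible x

variable {P}

/-- `T` is obtained from the subposet `S` by removing one element of `IrrStar S` that is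
retractible in `S`. -/
def RetractStep (S T : Set P) : Prop :=
  ∃ x : S, x ∈ IrrStar S ∧ IsRetractible x ∧ T = S \ {x.1}

/-- `T` is obtained from the subposet `S` by removing one pendant vertex of `S`. -/
def PendantStep (S T : Set P) : Prop :=
  ∃ x : S, IsPendant x ∧ T = S \ {x.1}

/-- `B` is (up to isomorphism) a basic block associated to the poset `P`: retractible elements
are removed from `P` one after the other until a basic retract `R` is reached; then pendant
vertices, and retractible elements formed on the way, are removed one after the other until
there are none of either kind. -/
def IsBasicBlockAssociatedTo (B : Type*) [PartialOrder B] (P : Type*) [PartialOrder P] : Prop :=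
  ∃ R T : Set P,
    Relation.ReflTransGen RetractStep Set.univ R ∧ IsBasicRetract R ∧
    Relation.ReflTransGen (fun S S' => PendantStep S S' ∨ RetractStep S S') R T ∧
    (∀ x : T, ¬ IsPendant x) ∧ IsBasicRetract T ∧
    Nonempty (B ≃o T)

end Posets

section Lattices

/-- A block: a lattice whose largest element is join-reducible and whose least element is
meet-reducible. (A finite lattice is the maximal block of some lattice if and only if it is a
block, as it is then its own maximal block.) -/
def IsBlock (L : Type*) [Lattice L] : Prop :=
  (∃ t : L, IsTop t ∧ ∃ y z : L, y ≠ t ∧ z ≠ t ∧ y ⊔ z = t) ∧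
  (∃ b : L, IsBot b ∧ ∃ y z : L, y ≠ b ∧ z ≠ b ∧ y ⊓ z = b)

/-- A basic block: a one-element lattice, or a block in which there are no doubly irreducible
elements or the removal of any doubly irreducible element reduces the nullity by one. -/
def IsBasicBlock (L : Type*) [Lattice L] : Prop :=
  Nat.card L = 1 ∨
    (IsBlock L ∧ (Irr L = ∅ ∨ ∀ x ∈ Irr L, nullity {y : L // y ≠ x} = nullity L - 1))

/-- Inside a poset, the subset `S₁ ∪ S₂` (with the induced order) is the adjunct
`S₁ ]_a^b S₂` of its disjoint subsets `S₁` and `S₂` with respect to the pair `(a, b)`, where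
`a < b` in `S₁` and `b` does not cover `a` in `S₁`. -/
structure IsAdjunct {L : Type*} [PartialOrder L] (S₁ S₂ : Set L) (a b : L) : Prop where
  disjoint : Disjoint S₁ S₂
  left_mem : a ∈ S₁
  right_mem : b ∈ S₁
  lt : a < b
  not_covBy : ∃ c ∈ S₁, a < c ∧ c < b
  le_iff : ∀ x ∈ S₁, ∀ y ∈ S₂, x ≤ y ↔ x ≤ a
  ge_iff : ∀ x ∈ S₁, ∀ y ∈ S₂, y ≤ x ↔ b ≤ x

/-- An adjunct representation `L = C₀ ]_{a₁}^{b₁} C₁ ]_{a₂}^{b₂} C₂ ⋯ ]_{a_k}^{b_k} C_k` of `L`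
by (nonempty) chains, in which `C₀` is a maximal chain that contains all `a_i`, `b_i`.
The `i`-th adjunct operation is applied to `C₀ ∪ ⋯ ∪ C_i` and `C_{i+1}`. -/
structure AdjunctRep (L : Type*) [PartialOrder L] (k : ℕ) where
  C : Fin (k + 1) → Set L
  a : Fin k → L
  b : Fin k → L
  nonempty : ∀ i, (C i).Nonempty
  chain : ∀ i, IsChain (· ≤ ·) (C i)
  isMaxChain_zero : IsMaxChain (· ≤ ·) (C 0)
  a_mem : ∀ i, a i ∈ C 0
  b_mem : ∀ i, b i ∈ C 0
  adjunct : ∀ i : Fin k, IsAdjunct (⋃ j ≤ i.castSucc, C j) (C i.succ) (a i) (b i)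
  union : ⋃ j, C j = Set.univ

namespace AdjunctRep

variable {L : Type*} [PartialOrder L] {k : ℕ} (R : AdjunctRep L k)

/-- The set of (distinct) adjunct pairs. -/
def pairs : Set (L × L) := Set.range fun i => (R.a i, R.b i)

/-- The multiplicity of an adjunct pair. -/
noncomputable def mult (q : L × L) : ℕ := {i | (R.a i, R.b i) = q}.ncard

/-- The adjunct pairs `(a, b)` such that the open interval `(a, b)` consists of doubly
irreducible elements. -/
def innerPairs : Set (L × L) := {q ∈ R.pairs | Set.Ioo q.1 q.2 ⊆ Irr L}

/-- The adjunct pairs `(a, b)` such that the open interval `(a, b)` contains a reducible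
element. -/
def outerPairs : Set (L × L) := {q ∈ R.pairs | (Set.Ioo q.1 q.2 ∩ Red L).Nonempty}

end AdjunctRep

/-- Isomorphism of lattice structures on `V`. -/
def latticeIso (V : Type*) : Setoid (Lattice V) where
  r L L' := Nonempty (@OrderIso V V L.toLE L'.toLE)
  iseqv :=
    { refl := fun L => ⟨@OrderIso.refl V L.toLE⟩
      symm := fun {L L'} ⟨e⟩ => ⟨@OrderIso.symm V V L.toLE L'.toLE e⟩
      trans := fun {L L' L''} ⟨e⟩ ⟨f⟩ => ⟨@OrderIso.trans V V V L.toLE L'.toLE L''.toLE e f⟩ }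

/-- The lattice structures on `V` which are blocks of nullity `k` with exactly `r` reducible
elements, all comparable, and to which `B` is the associated basic block. -/
def blocksOn (V : Type*) (B : Type*) [PartialOrder B] (k r : ℕ) : Set (Lattice V) :=
  {_L : Lattice V | IsBlock V ∧ IsRC V ∧ nullity V = k ∧ (Red V).ncard = r ∧
    IsBasicBlockAssociatedTo B V}

/-- The number of isomorphism classes of blocks on `n` elements, of nullity `k`, with exactly
`r` reducible elements, all comparable, whose associated basic block is `B`. -/
noncomputable def numBlocks (n : ℕ) (B : Type*) [PartialOrder B] (k r : ℕ) : ℕ :=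
  ((Quotient.mk (latticeIso (Fin n))) '' blocksOn (Fin n) B k r).ncard

end Lattices

/-- The number of partitions of `n` into exactly `k` positive parts. -/
def partitionCount (n k : ℕ) : ℕ :=
  (Finset.univ.filter fun q : n.Partition => q.parts.card = k).card

end RCLattice

namespace RCLattice

/-! ### Retractibility and cover graphs of finite posets -/

section FinitePosets

variable {P : Type*} [PartialOrder P]

/-! A block whose reducible elements form a chain is a directed multigraph on that chain. Every
other element lies on a strand, a chain of doubly irreducible elements running between two reducible
ones. Call such a description a presentation (`Labeling`) by a `StrandGraph`. Whether two elements
on different parts are comparable can be read off from the ends of those parts. So the poset is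
determined up to isomorphism by the graph and the number of elements on each strand
(`Labeling.nonempty_orderIso`), and it determines both (`Labeling.exists_equiv`). The only
restriction on the lengths is that a strand may be empty only if it is thin.

Deleting a retractible element changes a length but not the graph (`Labeling.erase`). In a basic
retract all lengths are minimal: 0 on thin strands and 1 on the others (`Labeling.len_eq_minLen`).
Hence `B` is the associated basic block of a block exactly when both have the same graph
(`Labeling.isBasicBlockAssociatedTo_iff`). The count is therefore of length functions on the strands
of `B` with total `n - r`, up to isomorphism. A finite chain of vertices is rigid, so isomorphisms
only permute parallel strands. What remains is one multiset of lengths for each class of parallel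
strands (`numBlocks_eq`).

An adjunct representation lists the strands once more (`AdjunctRep.exists_equiv_strands`): each
adjoined chain is a strand, and the main chain supplies one further strand between any two
successive vertices. A pair with no reducible element inside thus has one strand more than its
multiplicity, and any other pair has exactly its multiplicity. All these strands are nonempty, so
their lengths form partitions. The remaining classes are the `l` thin strands, each alone in its
class and of arbitrary length, which contribute the factor 1. Counting strands through the nullity
gives `l = r - m - 1` and the size of `B`. -/

theorem le_getLast_of_isChain_covBy {z : P} : ∀ (l : List P) (a : P),
    (a :: l).IsChain (· ⋖ ·) → (a :: l).getLast? = some z → a ≤ z ∧ (l ≠ [] → a < z)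
  | [], a, _, h => by simp_all
  | b :: l, a, hc, h => by
    rw [List.isChain_cons_cons] at hc
    have := le_getLast_of_isChain_covBy l b hc.2 (by simpa using h)
    exact ⟨hc.1.le.trans this.1, fun _ => hc.1.lt.trans_le this.1⟩

/-- A doubly irreducible element `x` with `y ⋖ x ⋖ z` is retractible if and only if it is the only
element strictly between `y` and `z`. -/
theorem isRetractible_iff [Finite P] {x y z : P} (hx : x ∈ IrrStar P) (hy : y ⋖ x) (hz : x ⋖ z) :
    IsRetractible x ↔ ∀ w, y < w → w < z → w = x := by
  have huy : ∀ v, v ⋖ x → v = y := fun v hv => hx.1.unique hv hy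
  have huz : ∀ v, x ⋖ v → v = z := fun v hv => hx.2.unique hv hz
  have hirr : x ∈ Irr P :=
    ⟨fun a ha b hb => hx.1.unique ha hb, fun a ha b hb => hx.2.unique ha hb⟩
  constructor
  · rintro ⟨-, h | ⟨y', hy', z', hz', h1, h2, h3⟩⟩ w hyw hwz
    -- If `y` is irreducible, `x` is its only upper cover, so everything above `y` is above `x`;
    -- dually for `z`. If both are reducible, the first alternative of retractibility fails.
    · by_cases hyR : y ∈ Irr P
      · obtain ⟨u, hyu, huw⟩ := hyw.exists_covby_le
        obtain rfl : u = x := hyR.2 hyu hy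
        exact (hz.eq_or_eq huw hwz.le).resolve_right hwz.ne
      · by_cases hzR : z ∈ Irr P
        · obtain ⟨u, hwu, huz⟩ := hwz.exists_le_covby
          obtain rfl : u = x := hzR.1 huz hz
          exact (hy.eq_or_eq hyw.le hwu).resolve_left hyw.ne'
        · exact absurd ⟨y, hyR, z, hzR, hy, hz⟩ h
    · obtain rfl := huy _ h1
      obtain rfl := huz _ h2
      obtain ⟨u, hyu, huw⟩ := hyw.exists_covby_le
      have huz' : u ≤ z' := huw.trans hwz.le
      have : Relation.ReflTransGen (· ⋖ ·) u z' := by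
        have := Fintype.ofFinite P
        classical
        let _ : LocallyFiniteOrder P := Fintype.toLocallyFiniteOrder
        exact le_iff_reflTransGen_covBy.1 huz'
      obtain ⟨l, hl, hlast⟩ := List.exists_isChain_cons_of_relationReflTransGen this
      -- A covering path through `w` must be the path through `x`, so its second vertex is `x`.
      have := h3 (y' :: u :: l) (List.isChain_cons_cons.2 ⟨hyu, hl⟩) rfl (by
        rw [List.getLast?_eq_getLast_of_ne_nil (by simp)]
        simpa using hlast)
      obtain rfl : u = x := by simp at this; exact this.1
      exact (hz.eq_or_eq huw hwz.le).resolve_right hwz.ne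
  · intro h
    refine ⟨hirr, ?_⟩
    by_cases hR : y ∈ Red P ∧ z ∈ Red P
    · right
      refine ⟨y, hR.1, z, hR.2, hy, hz, ?_⟩
      intro w hw hh hl
      match w, hw, hh, hl with
      | [], _, hh, _ => simp at hh
      | [a], _, hh, hl =>
        simp at hh hl
        exact absurd (hh.symm.trans hl) (hy.lt.trans hz.lt).ne
      | a :: u :: l, hw, hh, hl =>
        obtain rfl : a = y := by simpa using hh
        rw [List.isChain_cons_cons] at hw
        have h1 := le_getLast_of_isChain_covBy l u hw.2 (by simpa using hl)
        have hux : u = x := by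
          refine h u hw.1.lt (h1.1.lt_of_ne ?_)
          rintro rfl
          exact hw.1.2 hy.lt hz.lt
        subst hux
        match l, hw, h1, hl with
        | [], hw, h1, hl => simp at hl; exact absurd hl hz.lt.ne
        | v :: l', hw, h1, hl =>
          have hw2 := hw.2
          rw [List.isChain_cons_cons] at hw2
          obtain rfl := huz _ hw2.1
          have h2 := le_getLast_of_isChain_covBy l' v hw2.2 (by simpa using hl)
          by_cases hl' : l' = []
          · simp [hl']
          · exact absurd (h2.2 hl') (lt_irrefl _)
    · left
      rintro ⟨y', hy', z', hz', h1, h2⟩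
      obtain rfl := huy _ h1
      obtain rfl := huz _ h2
      exact hR ⟨hy', hz'⟩

/-- Each edge of the cover graph has exactly one upward orientation. -/
theorem ncard_edgeSet_hasse :
    (SimpleGraph.hasse P).edgeSet.ncard = Nat.card {p : P × P // p.1 ⋖ p.2} := by
  have : (SimpleGraph.hasse P).edgeSet = (fun p : P × P => s(p.1, p.2)) '' {p | p.1 ⋖ p.2} := by
    ext e
    induction e using Sym2.ind with
    | _ a b =>
      simp only [SimpleGraph.mem_edgeSet, SimpleGraph.hasse_adj, Set.mem_image, Set.mem_ofPred_eq,
        Prod.exists, Sym2.eq_iff]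
      constructor
      · rintro (h | h)
        · exact ⟨a, b, h, Or.inl ⟨rfl, rfl⟩⟩
        · exact ⟨b, a, h, Or.inr ⟨rfl, rfl⟩⟩
      · rintro ⟨x, y, h, (⟨rfl, rfl⟩ | ⟨rfl, rfl⟩)⟩
        · exact Or.inl h
        · exact Or.inr h
  rw [this, Set.InjOn.ncard_image, ← Nat.card_coe_set_eq]
  · rfl
  · rintro ⟨a, b⟩ h ⟨c, d⟩ h' heq
    rcases Sym2.eq_iff.1 heq with ⟨h1, h2⟩ | ⟨h1, h2⟩
    · exact Prod.ext h1 h2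
    · simp only [Set.mem_ofPred_eq] at h h'
      simp only at h1 h2
      subst h1 h2
      exact absurd h.lt h'.lt.asymm

theorem card_connectedComponent_hasse [Finite P] {o : P} (ho : ∀ x, o ≤ x) :
    Nat.card (SimpleGraph.hasse P).ConnectedComponent = 1 := by
  have key : ∀ x, (SimpleGraph.hasse P).Reachable o x := by
    intro x
    induction x using WellFoundedLT.induction with
    | _ x ih =>
      rcases (ho x).eq_or_lt with rfl | h
      · exact SimpleGraph.Reachable.refl _
      · obtain ⟨u, -, hu⟩ := h.exists_le_covby
        exact (ih u hu.lt).trans (SimpleGraph.Adj.reachable (SimpleGraph.hasse_adj.2 (Or.inl hu)))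
  rw [Nat.card_eq_one_iff_unique]
  refine ⟨⟨fun a b => ?_⟩, ⟨SimpleGraph.connectedComponentMk _ o⟩⟩
  induction a using SimpleGraph.ConnectedComponent.ind with
  | _ a =>
    induction b using SimpleGraph.ConnectedComponent.ind with
    | _ b => exact SimpleGraph.ConnectedComponent.sound ((key a).symm.trans (key b))

end FinitePosets

-- Strand graphs and presentations of posets

universe u v w

/-- A multigraph on a linearly ordered vertex set `I` whose edges ("strands") `E` are directed
upwards, join any two successive vertices, and meet each vertex in two edges on one side. -/
structure StrandGraph (I : Type u) (E : Type v) [LinearOrder I] where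
  s : E → I
  t : E → I
  lt : ∀ e, s e < t e
  exists_of_covBy : ∀ i j, i ⋖ j → ∃ e, s e = i ∧ t e = j
  branching : ∀ i, (∃ e e', e ≠ e' ∧ s e = i ∧ s e' = i) ∨ (∃ e e', e ≠ e' ∧ t e = i ∧ t e' = i)

namespace StrandGraph

variable {I : Type u} {E : Type v} [LinearOrder I] (G : StrandGraph I E)

/-- With `hi`, this locates a part of the poset among the vertices: elements `x`, `y` of different
parts satisfy `x ≤ y` exactly when `hi` of the first part is at most `lo` of the second. -/
def lo : I ⊕ E → I := Sum.elim id G.s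

def hi : I ⊕ E → I := Sum.elim id G.t

@[simp] theorem lo_inl (i : I) : G.lo (Sum.inl i) = i := rfl
@[simp] theorem lo_inr (e : E) : G.lo (Sum.inr e) = G.s e := rfl
@[simp] theorem hi_inl (i : I) : G.hi (Sum.inl i) = i := rfl
@[simp] theorem hi_inr (e : E) : G.hi (Sum.inr e) = G.t e := rfl

theorem lo_le_hi : ∀ z, G.lo z ≤ G.hi z
  | Sum.inl _ => le_rfl
  | Sum.inr e => (G.lt e).le

/-- A strand is thin if it is the only strand between its ends, which are successive vertices. -/
def Thin (e : E) : Prop := G.s e ⋖ G.t e ∧ ∀ e', G.s e' = G.s e → G.t e' = G.t e → e' = e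

/-- The graph with all strands reversed. -/
def dual : StrandGraph Iᵒᵈ E where
  s e := OrderDual.toDual (G.t e)
  t e := OrderDual.toDual (G.s e)
  lt e := OrderDual.toDual_lt_toDual.2 (G.lt e)
  exists_of_covBy i j h :=
    let ⟨e, h1, h2⟩ := G.exists_of_covBy j.ofDual i.ofDual h.ofDual
    ⟨e, h2, h1⟩
  branching i := (G.branching i.ofDual).symm

theorem dual_thin {e : E} : G.dual.Thin e ↔ G.Thin e := by
  unfold Thin dual
  simp only [OrderDual.toDual_inj]
  rw [toDual_covBy_toDual_iff]
  exact and_congr_right fun _ => forall_congr' fun _ => imp.swap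

end StrandGraph

/-- A presentation of the poset `P` by a strand graph: the vertices are elements `c i` of `P`, all
other elements are distributed on the strands, each of which is a chain between its ends. Only
thin strands may be empty. -/
structure Labeling {I : Type u} {E : Type v} [LinearOrder I] (G : StrandGraph I E)
    (P : Type w) [PartialOrder P] where
  q : P → I ⊕ E
  c : I → P
  q_c : ∀ i, q (c i) = Sum.inl i
  eq_c : ∀ x i, q x = Sum.inl i → x = c i
  chain : ∀ x y, q x = q y → x ≤ y ∨ y ≤ x
  of_le : ∀ x y, x ≤ y → q x = q y ∨ G.hi (q x) ≤ G.lo (q y)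
  le_of : ∀ x y, G.hi (q x) ≤ G.lo (q y) → x ≤ y
  thin : ∀ e, (∀ x, q x ≠ Sum.inr e) → G.Thin e

/-! ### Covers and reducible elements of a presented poset -/

namespace Labeling

variable {I : Type u} {E : Type v} [LinearOrder I] {G : StrandGraph I E} {P : Type w}
  [PartialOrder P]

/-- The reversed presentation of the dual poset. -/
def dual (Λ : Labeling G P) : Labeling G.dual Pᵒᵈ where
  q x := Λ.q x.ofDual
  c i := OrderDual.toDual (Λ.c i.ofDual)
  q_c i := Λ.q_c i.ofDual
  eq_c x i h := Λ.eq_c x.ofDual i.ofDual h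
  chain x y h := (Λ.chain x.ofDual y.ofDual h).symm
  of_le x y h := by
    rcases Λ.of_le y.ofDual x.ofDual h with h | h
    · exact Or.inl h.symm
    · right
      cases hx : Λ.q x.ofDual <;> cases hy : Λ.q y.ofDual <;> rw [hx, hy] at h <;> exact h
  le_of x y h := by
    refine Λ.le_of y.ofDual x.ofDual ?_
    cases hx : Λ.q x.ofDual <;> cases hy : Λ.q y.ofDual <;> rw [hx, hy] at h <;> exact h
  thin e h := G.dual_thin.2 (Λ.thin e fun x => h (OrderDual.toDual x))

variable (Λ : Labeling G P)

@[simp] theorem q_c' (i : I) : Λ.q (Λ.c i) = Sum.inl i := Λ.q_c i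

theorem lo_le_lo {x y : P} (h : x ≤ y) : G.lo (Λ.q x) ≤ G.lo (Λ.q y) := by
  rcases Λ.of_le x y h with h | h
  · rw [h]
  · exact (G.lo_le_hi _).trans h

theorem hi_le_hi {x y : P} (h : x ≤ y) : G.hi (Λ.q x) ≤ G.hi (Λ.q y) := by
  rcases Λ.of_le x y h with h | h
  · rw [h]
  · exact h.trans (G.lo_le_hi _)

theorem c_le_iff {i : I} {x : P} : Λ.c i ≤ x ↔ i ≤ G.lo (Λ.q x) := by
  constructor
  · intro h; simpa using Λ.lo_le_lo h
  · intro h; exact Λ.le_of _ _ (by simpa using h)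

theorem le_c_iff {i : I} {x : P} : x ≤ Λ.c i ↔ G.hi (Λ.q x) ≤ i := by
  constructor
  · intro h; simpa using Λ.hi_le_hi h
  · intro h; exact Λ.le_of _ _ (by simpa using h)

@[simp] theorem c_le_c {i j : I} : Λ.c i ≤ Λ.c j ↔ i ≤ j := by simp [c_le_iff]

theorem c_injective : Function.Injective Λ.c := fun i j h => by
  have := congrArg Λ.q h; simpa using this

@[simp] theorem c_lt_c {i j : I} : Λ.c i < Λ.c j ↔ i < j := by
  rw [lt_iff_le_not_ge, Λ.c_le_c, Λ.c_le_c, lt_iff_le_not_ge]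

theorem c_ne {x : P} {e : E} (h : Λ.q x = Sum.inr e) (i : I) : Λ.c i ≠ x := by
  rintro rfl; simp at h

theorem c_lt {x : P} {e : E} (h : Λ.q x = Sum.inr e) : Λ.c (G.s e) < x :=
  lt_of_le_of_ne (Λ.c_le_iff.2 (by simp [h])) (Λ.c_ne h _)

theorem lt_c {x : P} {e : E} (h : Λ.q x = Sum.inr e) : x < Λ.c (G.t e) :=
  lt_of_le_of_ne (Λ.le_c_iff.2 (by simp [h])) (Λ.c_ne h _).symm

/-- The first element above the lower end of a strand. -/
theorem exists_first [Finite P] (e : E) : ∃ x, Λ.c (G.s e) ⋖ x ∧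
    ((Λ.q x = Sum.inr e ∧ ∀ y, Λ.q y = Sum.inr e → x ≤ y) ∨
      (x = Λ.c (G.t e) ∧ ∀ y, Λ.q y ≠ Sum.inr e)) := by
  by_cases hne : ∃ x, Λ.q x = Sum.inr e
  · obtain ⟨x, hx, hmin⟩ := WellFounded.has_min (wellFounded_lt (α := P))
      {x | Λ.q x = Sum.inr e} hne
    refine ⟨x, ⟨Λ.c_lt hx, ?_⟩, Or.inl ⟨hx, ?_⟩⟩
    · intro w h1 h2
      rcases Λ.of_le w x h2.le with h | h
      · exact hmin w (h.trans hx) h2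
      · have hx' : Λ.q x = Sum.inr e := hx
        rw [hx', G.lo_inr, ← Λ.le_c_iff] at h
        exact absurd h1 h.not_gt
    · intro y hy
      rcases Λ.chain x y (hx.trans hy.symm) with h | h
      · exact h
      · exact (eq_or_lt_of_le h).elim (fun h => h.ge) fun h => absurd h (hmin y hy)
  · push Not at hne
    -- The strand is empty, hence thin. An element strictly between its ends would be a vertex
    -- between successive vertices or lie on a parallel strand, and there are neither.
    have hth := Λ.thin e hne
    refine ⟨Λ.c (G.t e), ⟨by simpa using G.lt e, ?_⟩, Or.inr ⟨rfl, hne⟩⟩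
    intro w h1 h2
    have h1' := Λ.c_le_iff.1 h1.le
    have h2' := Λ.le_c_iff.1 h2.le
    cases hw : Λ.q w with
    | inl j =>
      obtain rfl := Λ.eq_c _ _ hw
      exact hth.1.2 (by simpa using h1) (by simpa using h2)
    | inr e' =>
      rw [hw] at h1' h2'
      simp only [G.lo_inr, G.hi_inr] at h1' h2'
      have hs : G.s e' = G.s e :=
        (hth.1.eq_or_eq h1' ((G.lt e').le.trans h2')).resolve_right ((G.lt e').trans_le h2').ne
      have ht : G.t e' = G.t e :=
        (hth.1.eq_or_eq (h1'.trans (G.lt e').le) h2').resolve_left (h1'.trans_lt (G.lt e')).ne'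
      exact hne w (hth.2 e' hs ht ▸ hw)

/-- The upper cover of the lower end of a strand in the direction of the strand. -/
noncomputable def first [Finite P] (e : E) : P := (Λ.exists_first e).choose

theorem c_covBy_first [Finite P] (e : E) : Λ.c (G.s e) ⋖ Λ.first e :=
  (Λ.exists_first e).choose_spec.1

theorem first_spec [Finite P] (e : E) :
    (Λ.q (Λ.first e) = Sum.inr e ∧ ∀ y, Λ.q y = Sum.inr e → Λ.first e ≤ y) ∨
      (Λ.first e = Λ.c (G.t e) ∧ ∀ y, Λ.q y ≠ Sum.inr e) :=
  (Λ.exists_first e).choose_spec.2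

/-- If the cover is an inner element of a strand, it names the strand. If it is a vertex, both
strands are empty, hence thin and parallel, hence equal. -/
theorem first_injective [Finite P] {e e' : E} (hs : G.s e = G.s e')
    (h : Λ.first e = Λ.first e') : e = e' := by
  rcases Λ.first_spec e with ⟨h1, -⟩ | ⟨h1, h1'⟩ <;>
    rcases Λ.first_spec e' with ⟨h2, -⟩ | ⟨h2, h2'⟩
  · rw [h, h2] at h1; simpa using h1.symm
  · exact absurd (h2.symm.trans h.symm) (Λ.c_ne h1 _)
  · exact absurd (h1.symm.trans h) (Λ.c_ne h2 _)
  · exact (Λ.thin e' h2').2 e hs (Λ.c_injective (h1.symm.trans (h.trans h2)))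

theorem exists_eq_first [Finite P] {i : I} {x : P} (h : Λ.c i ⋖ x) :
    ∃ e, G.s e = i ∧ Λ.first e = x := by
  have key : ∃ e, G.s e = i ∧ Λ.first e ≤ x := by
    cases hx : Λ.q x with
    | inl j =>
      obtain rfl := Λ.eq_c _ _ hx
      have hij : i ⋖ j := ⟨by simpa using h.lt, fun k hk hk' => h.2 (c := Λ.c k) (by simpa) (by simpa)⟩
      obtain ⟨e, rfl, rfl⟩ := G.exists_of_covBy i j hij
      refine ⟨e, rfl, ?_⟩
      rcases Λ.first_spec e with ⟨h1, -⟩ | ⟨h1, -⟩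
      · exact (Λ.lt_c h1).le
      · exact h1.le
    | inr e =>
      have h1 := Λ.c_le_iff.1 h.le
      rw [hx, G.lo_inr] at h1
      have h2 : i = G.s e := by
        refine (eq_or_lt_of_le h1).resolve_right fun h1 => ?_
        exact h.2 (c := Λ.c (G.s e)) (by simpa) (Λ.c_lt hx)
      refine ⟨e, h2.symm, ?_⟩
      rcases Λ.first_spec e with ⟨-, h1⟩ | ⟨-, h1⟩
      · exact h1 _ hx
      · exact absurd hx (h1 _)
  obtain ⟨e, rfl, h1⟩ := key
  exact ⟨e, rfl, (h.eq_or_eq (Λ.c_covBy_first e).le h1).resolve_left (Λ.c_covBy_first e).lt.ne'⟩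

theorem covBy_subsingleton {x : P} {e : E} (h : Λ.q x = Sum.inr e) :
    {y | x ⋖ y}.Subsingleton := by
  have key : ∀ y, x ⋖ y → Λ.q y = Sum.inr e ∨ y = Λ.c (G.t e) := by
    intro y hy
    rcases Λ.of_le x y hy.le with h1 | h1
    · exact Or.inl (h1.symm.trans h)
    · rw [h, G.hi_inr, ← Λ.c_le_iff] at h1
      exact Or.inr ((hy.eq_or_eq (Λ.lt_c h).le h1).resolve_left (Λ.lt_c h).ne').symm
  have aux : ∀ y y', x ⋖ y → x ⋖ y' → y ≤ y' → y = y' := fun y y' h1 h2 h3 =>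
    (h2.eq_or_eq h1.le h3).resolve_left h1.lt.ne'
  intro y hy y' hy'
  rcases key y hy with h1 | h1 <;> rcases key y' hy' with h2 | h2
  · rcases Λ.chain y y' (h1.trans h2.symm) with h3 | h3
    · exact aux _ _ hy hy' h3
    · exact (aux _ _ hy' hy h3).symm
  · exact aux _ _ hy hy' (h2 ▸ (Λ.lt_c h1).le)
  · exact (aux _ _ hy' hy (h1 ▸ (Λ.lt_c h2).le)).symm
  · rw [h1, h2]

theorem existsUnique_covBy [Finite P] {x : P} {e : E} (h : Λ.q x = Sum.inr e) : ∃! y, x ⋖ y := by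
  obtain ⟨y, hy, -⟩ := (Λ.lt_c h).exists_covby_le
  exact ⟨y, hy, fun z hz => Λ.covBy_subsingleton h hz hy⟩

theorem existsUnique_covBy' [Finite P] {x : P} {e : E} (h : Λ.q x = Sum.inr e) : ∃! y, y ⋖ x := by
  obtain ⟨y, hy, hy'⟩ := Λ.dual.existsUnique_covBy (x := OrderDual.toDual x) h
  exact ⟨y.ofDual, hy.ofDual, fun z hz => hy' (OrderDual.toDual z) hz.toDual⟩

/-- Strands leaving a vertex upwards correspond to its upper covers, and dually, so the branching
condition on the graph makes every vertex reducible. -/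
theorem two_covers [Finite P] (i : I) :
    (∃ y z, y ≠ z ∧ Λ.c i ⋖ y ∧ Λ.c i ⋖ z) ∨ (∃ y z, y ≠ z ∧ y ⋖ Λ.c i ∧ z ⋖ Λ.c i) := by
  rcases G.branching i with ⟨e, e', hne, rfl, h⟩ | ⟨e, e', hne, rfl, h⟩
  · left
    exact ⟨_, _, fun h' => hne (Λ.first_injective h.symm h'), Λ.c_covBy_first e,
      h ▸ Λ.c_covBy_first e'⟩
  · right
    have h' : G.dual.s e = G.dual.s e' := congrArg OrderDual.toDual h.symm
    refine ⟨(Λ.dual.first e).ofDual, (Λ.dual.first e').ofDual,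
      fun h2 => hne (Λ.dual.first_injective h' h2), (Λ.dual.c_covBy_first e).ofDual, ?_⟩
    have := (Λ.dual.c_covBy_first e').ofDual
    rw [← h'] at this
    exact this

theorem c_mem_red [Finite P] (i : I) : Λ.c i ∈ Red P := by
  rintro ⟨h1, h2⟩
  rcases Λ.two_covers i with ⟨y, z, hne, hy, hz⟩ | ⟨y, z, hne, hy, hz⟩
  · exact hne (h2 hy hz)
  · exact hne (h1 hy hz)

theorem mem_irrStar_of [Finite P] {x : P} {e : E} (h : Λ.q x = Sum.inr e) : x ∈ IrrStar P :=
  ⟨Λ.existsUnique_covBy' h, Λ.existsUnique_covBy h⟩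

theorem irrStar_subset : IrrStar P ⊆ Irr P := fun _ h =>
  ⟨fun _ ha _ hb => h.1.unique ha hb, fun _ ha _ hb => h.2.unique ha hb⟩

theorem mem_irr_iff [Finite P] {x : P} : x ∈ Irr P ↔ ∃ e, Λ.q x = Sum.inr e := by
  constructor
  · intro h
    cases hx : Λ.q x with
    | inl i => exact absurd h (Λ.eq_c _ _ hx ▸ Λ.c_mem_red i)
    | inr e => exact ⟨e, rfl⟩
  · rintro ⟨e, h⟩
    exact irrStar_subset (Λ.mem_irrStar_of h)

theorem mem_irrStar_iff [Finite P] {x : P} : x ∈ IrrStar P ↔ ∃ e, Λ.q x = Sum.inr e :=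
  ⟨fun h => Λ.mem_irr_iff.1 (irrStar_subset h), fun ⟨_, h⟩ => Λ.mem_irrStar_of h⟩

theorem red_eq_range [Finite P] : Red P = Set.range Λ.c := by
  ext x
  constructor
  · intro h
    cases hx : Λ.q x with
    | inl i => exact ⟨i, (Λ.eq_c _ _ hx).symm⟩
    | inr e => exact absurd (Λ.mem_irr_iff.2 ⟨e, hx⟩) h
  · rintro ⟨i, rfl⟩
    exact Λ.c_mem_red i

theorem isRC (Λ : Labeling G P) [Finite P] : IsRC P := by
  unfold IsRC
  rw [Λ.red_eq_range]
  rintro _ ⟨i, rfl⟩ _ ⟨j, rfl⟩ -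
  simpa using le_total i j

theorem ncard_red (Λ : Labeling G P) [Finite P] : (Red P).ncard = Nat.card I := by
  rw [Λ.red_eq_range, ← Set.image_univ, Set.InjOn.ncard_image Λ.c_injective.injOn, Set.ncard_univ]

theorem not_isPendant (Λ : Labeling G P) [Finite P] (x : P) : ¬ IsPendant x := by
  unfold IsPendant
  rw [Set.ncard_eq_one]
  rintro ⟨a, ha⟩
  have key : ∀ y z, y ≠ z → (SimpleGraph.hasse P).Adj x y → (SimpleGraph.hasse P).Adj x z →
      False := by
    intro y z hne hy hz
    have hy' : y ∈ (SimpleGraph.hasse P).neighborSet x := hy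
    have hz' : z ∈ (SimpleGraph.hasse P).neighborSet x := hz
    rw [ha] at hy' hz'
    exact hne (hy'.trans hz'.symm)
  simp only [SimpleGraph.hasse_adj] at key
  cases hx : Λ.q x with
  | inl i =>
    obtain rfl := Λ.eq_c _ _ hx
    rcases Λ.two_covers i with ⟨y, z, hne, hy, hz⟩ | ⟨y, z, hne, hy, hz⟩
    · exact key y z hne (Or.inl hy) (Or.inl hz)
    · exact key y z hne (Or.inr hy) (Or.inr hz)
  | inr e =>
    obtain ⟨y, hy, -⟩ := Λ.existsUnique_covBy hx
    obtain ⟨z, hz, -⟩ := Λ.existsUnique_covBy' hx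
    exact key y z (hz.lt.trans hy.lt).ne' (Or.inl hy) (Or.inr hz)

end Labeling

/-! ### Nullity, deletion, strand lengths and uniqueness of presentations -/

namespace Labeling

variable {I : Type u} {E : Type v} [LinearOrder I] {G : StrandGraph I E} {P : Type w}
  [PartialOrder P]

theorem c_bot_le (Λ : Labeling G P) [Finite I] [Nonempty I] : ∃ i, ∀ x, Λ.c i ≤ x := by
  obtain ⟨i, hi⟩ := Finite.exists_min (id : I → I)
  exact ⟨i, fun x => Λ.c_le_iff.2 (hi _)⟩

theorem finite_vertices (Λ : Labeling G P) [Finite P] : Finite I :=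
  Finite.of_injective _ Λ.c_injective

theorem finite_strands (Λ : Labeling G P) [Finite P] : Finite E :=
  Finite.of_injective (fun e => (Λ.c (G.s e), Λ.first e)) fun e e' h => by
    simp only [Prod.mk.injEq] at h
    exact Λ.first_injective (Λ.c_injective h.1) h.2

theorem card_eq_add (Λ : Labeling G P) [Finite P] :
    Nat.card P = Nat.card I + Nat.card {x : P // ∃ e, Λ.q x = Sum.inr e} := by
  have := Λ.finite_vertices
  rw [← Nat.card_sum]
  symm
  refine Nat.card_congr (Equiv.ofBijective (Sum.elim Λ.c Subtype.val) ⟨?_, ?_⟩)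
  · rintro (i | ⟨x, e, hx⟩) (j | ⟨y, e', hy⟩) h
    · exact congrArg _ (Λ.c_injective h)
    · exact absurd h (Λ.c_ne hy _)
    · exact absurd h.symm (Λ.c_ne hx _)
    · exact congrArg _ (Subtype.ext h)
  · intro x
    cases hx : Λ.q x with
    | inl i => exact ⟨Sum.inl i, (Λ.eq_c _ _ hx).symm⟩
    | inr e => exact ⟨Sum.inr ⟨x, e, hx⟩, rfl⟩

/-- Each covering pair starts either at a vertex, where it picks a strand, or at a strand element,
which has a single upper cover. -/
theorem card_covBy (Λ : Labeling G P) [Finite P] :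
    Nat.card {p : P × P // p.1 ⋖ p.2} =
      Nat.card E + Nat.card {x : P // ∃ e, Λ.q x = Sum.inr e} := by
  have := Λ.finite_strands
  have hn : ∀ x : {x : P // ∃ e, Λ.q x = Sum.inr e}, ∃ y, x.1 ⋖ y := fun x =>
    (Λ.existsUnique_covBy x.2.choose_spec).exists
  choose next hnext using hn
  rw [← Nat.card_sum]
  symm
  refine Nat.card_congr (Equiv.ofBijective (Sum.elim
    (fun e => ⟨(Λ.c (G.s e), Λ.first e), Λ.c_covBy_first e⟩)
    (fun x => ⟨(x.1, next x), hnext x⟩)) ⟨?_, ?_⟩)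
  · rintro (e | x) (e' | y) h <;>
      simp only [Sum.elim_inl, Sum.elim_inr, Subtype.mk.injEq, Prod.mk.injEq] at h
    · exact congrArg _ (Λ.first_injective (Λ.c_injective h.1) h.2)
    · exact absurd h.1 (Λ.c_ne y.2.choose_spec _)
    · exact absurd h.1.symm (Λ.c_ne x.2.choose_spec _)
    · exact congrArg _ (Subtype.ext h.1)
  · rintro ⟨⟨x, y⟩, h⟩
    cases hx : Λ.q x with
    | inl i =>
      obtain rfl := Λ.eq_c _ _ hx
      obtain ⟨e, rfl, rfl⟩ := Λ.exists_eq_first h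
      exact ⟨Sum.inl e, rfl⟩
    | inr e =>
      refine ⟨Sum.inr ⟨x, e, hx⟩, ?_⟩
      have := Λ.covBy_subsingleton hx (hnext ⟨x, e, hx⟩) h
      simp [this]

/-- Each strand element adds one vertex and one edge to the cover graph, so the lengths cancel. -/
theorem nullity_eq (Λ : Labeling G P) [Finite P] [Nonempty I] :
    nullity P = (Nat.card E : ℤ) - Nat.card I + 1 := by
  have := Λ.finite_vertices
  obtain ⟨i, hi⟩ := Λ.c_bot_le
  unfold nullity
  rw [ncard_edgeSet_hasse, card_connectedComponent_hasse hi, Λ.card_covBy, Λ.card_eq_add]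
  push_cast
  ring

/-- A retractible element can be deleted without changing the strand graph. -/
theorem erase (Λ : Labeling G P) [Finite P] {P' : Type*} [PartialOrder P'] (φ : P' ↪o P) (x : P)
    (hφ : ∀ y, y ∈ Set.range φ ↔ y ≠ x) (hx : x ∈ IrrStar P) (hr : IsRetractible x) :
    Nonempty (Labeling G P') := by
  obtain ⟨e, he⟩ := Λ.mem_irrStar_iff.1 hx
  have hc : ∀ i, ∃ y, φ y = Λ.c i := fun i => (hφ _).2 (Λ.c_ne he i)
  choose c hc using hc
  refine ⟨⟨fun y => Λ.q (φ y), c, fun i => by simp [hc], ?_, ?_, ?_, ?_, ?_⟩⟩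
  · intro y i h
    exact φ.injective ((Λ.eq_c _ _ h).trans (hc i).symm)
  · intro y z h
    simpa using Λ.chain _ _ h
  · intro y z h
    exact Λ.of_le _ _ (φ.monotone h)
  · intro y z h
    exact φ.le_iff_le.1 (Λ.le_of _ _ h)
  · intro e' he'
    by_cases hne : ∀ y, Λ.q y ≠ Sum.inr e'
    · exact Λ.thin _ hne
    push Not at hne
    have honly : ∀ y, Λ.q y = Sum.inr e' → y = x := by
      intro y hy
      by_contra hyx
      obtain ⟨z, rfl⟩ := (hφ y).2 hyx
      exact he' z hy
    obtain ⟨y, hy⟩ := hne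
    obtain rfl := honly y hy
    obtain rfl : e = e' := by rw [hy] at he; simpa using he.symm
    have h1 : Λ.c (G.s e) ⋖ y := by
      have := Λ.c_covBy_first e
      rcases Λ.first_spec e with ⟨h, -⟩ | ⟨-, h⟩
      · rwa [honly _ h] at this
      · exact absurd hy (h _)
    have h2 : y ⋖ Λ.c (G.t e) := by
      have := (Λ.dual.c_covBy_first e).ofDual
      rcases Λ.dual.first_spec e with ⟨h, -⟩ | ⟨-, h⟩
      · rwa [show (Λ.dual.first e) = OrderDual.toDual y from honly (Λ.dual.first e).ofDual h]
          at this
      · exact absurd hy (h (OrderDual.toDual y))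
    -- The deleted element was alone on its strand. Retractibility says nothing else lies between
    -- the ends, so there is no intermediate vertex and no nonempty parallel strand; an empty
    -- parallel strand would itself be thin, hence equal to this one.
    have h3 := (isRetractible_iff hx h1 h2).1 hr
    refine ⟨⟨G.lt e, fun j hj hj' => ?_⟩, fun e' hs ht => ?_⟩
    · exact Λ.c_ne he j (h3 (Λ.c j) (by simpa) (by simpa))
    · by_cases hne : ∃ z, Λ.q z = Sum.inr e'
      · obtain ⟨z, hz⟩ := hne
        have := h3 z (hs ▸ Λ.c_lt hz) (ht ▸ Λ.lt_c hz)
        rw [this, he] at hz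
        simpa using hz.symm
      · push Not at hne
        exact ((Λ.thin e' hne).2 e hs.symm ht.symm).symm

/-- The number of elements on a strand. -/
noncomputable def len (Λ : Labeling G P) (e : E) : ℕ := Nat.card {x : P // Λ.q x = Sum.inr e}

open Classical in
/-- The least number of elements that a strand of the graph can have. -/
noncomputable def _root_.RCLattice.StrandGraph.minLen (G : StrandGraph I E) (e : E) : ℕ :=
  if G.Thin e then 0 else 1

theorem minLen_le_len (Λ : Labeling G P) [Finite P] (e : E) : G.minLen e ≤ Λ.len e := by
  unfold StrandGraph.minLen
  split_ifs with h
  · exact Nat.zero_le _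
  · have : ∃ x, Λ.q x = Sum.inr e := by
      by_contra h'
      push Not at h'
      exact h (Λ.thin e h')
    obtain ⟨x, hx⟩ := this
    have : Nonempty {x : P // Λ.q x = Sum.inr e} := ⟨⟨x, hx⟩⟩
    exact Nat.card_pos

theorem isRetractible_of_forall (Λ : Labeling G P) [Finite P] {x y z : P} {e : E}
    (hx : Λ.q x = Sum.inr e) (hy : y ⋖ x) (hz : x ⋖ z)
    (h : ∀ w, y < w → w < z → Λ.q w = Sum.inr e) : IsRetractible x := by
  rw [isRetractible_iff (Λ.mem_irrStar_of hx) hy hz]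
  intro w hyw hwz
  rcases Λ.chain w x ((h w hyw hwz).trans hx.symm) with h1 | h1
  · exact (hy.eq_or_eq hyw.le h1).resolve_left hyw.ne'
  · exact (hz.eq_or_eq h1 hwz.le).resolve_right hwz.ne

/-- An element on a thin strand, and the lower of two elements on any strand, has only elements of
its own strand between its two neighbours, so it would be retractible. -/
theorem len_eq_minLen (Λ : Labeling G P) [Finite P] (hP : IsBasicRetract P) (e : E) :
    Λ.len e = G.minLen e := by
  have h1 : G.Thin e → ∀ x, Λ.q x ≠ Sum.inr e := by
    intro hth x hx
    obtain ⟨z, hz, -⟩ := Λ.existsUnique_covBy hx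
    obtain ⟨y, hy, huy⟩ := Λ.existsUnique_covBy' hx
    refine hP x (Λ.mem_irrStar_of hx) (Λ.isRetractible_of_forall hx hy hz ?_)
    have hsy : Λ.c (G.s e) ≤ y := by
      obtain ⟨u, hu, hu'⟩ := (Λ.c_lt hx).exists_le_covby
      exact huy u hu' ▸ hu
    have hzt : z ≤ Λ.c (G.t e) := by
      obtain ⟨u, hu, hu'⟩ := (Λ.lt_c hx).exists_covby_le
      exact Λ.covBy_subsingleton hx hz hu ▸ hu'
    intro w h1 h2
    have h3 := hsy.trans_lt h1
    have h4 := h2.trans_le hzt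
    cases hw : Λ.q w with
    | inl j =>
      obtain rfl := Λ.eq_c _ _ hw
      exact absurd (by simpa using h4) (hth.1.2 (by simpa using h3))
    | inr e' =>
      have h3' := Λ.c_le_iff.1 h3.le
      have h4' := Λ.le_c_iff.1 h4.le
      rw [hw] at h3' h4'
      simp only [G.lo_inr, G.hi_inr] at h3' h4'
      have hs : G.s e' = G.s e :=
        (hth.1.eq_or_eq h3' ((G.lt e').le.trans h4')).resolve_right ((G.lt e').trans_le h4').ne
      have ht : G.t e' = G.t e :=
        (hth.1.eq_or_eq (h3'.trans (G.lt e').le) h4').resolve_left (h3'.trans_lt (G.lt e')).ne'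
      rw [hth.2 e' hs ht]
  have h2 : ∀ x x', Λ.q x = Sum.inr e → Λ.q x' = Sum.inr e → ¬ x < x' := by
    intro x x' hx hx' hlt
    obtain ⟨z, hz, hzx'⟩ := hlt.exists_covby_le
    obtain ⟨y, hy, huy⟩ := Λ.existsUnique_covBy' hx
    refine hP x (Λ.mem_irrStar_of hx) (Λ.isRetractible_of_forall hx hy hz ?_)
    have hsy : Λ.c (G.s e) ≤ y := by
      obtain ⟨u, hu, hu'⟩ := (Λ.c_lt hx).exists_le_covby
      exact huy u hu' ▸ hu
    intro w h1 h2
    rcases Λ.of_le w x' (h2.le.trans hzx') with h3 | h3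
    · exact h3.trans hx'
    · rw [hx', G.lo_inr, ← Λ.le_c_iff] at h3
      exact absurd (h3.trans hsy) h1.not_ge
  refine le_antisymm ?_ (Λ.minLen_le_len e)
  unfold StrandGraph.minLen len
  have hsub : Subsingleton {x : P // Λ.q x = Sum.inr e} := by
    refine ⟨fun x y => Subtype.ext ?_⟩
    rcases Λ.chain x.1 y.1 (x.2.trans y.2.symm) with h | h
    · exact h.eq_or_lt.resolve_right (h2 _ _ x.2 y.2)
    · exact (h.eq_or_lt.resolve_right (h2 _ _ y.2 x.2)).symm
  split_ifs with h
  · have : IsEmpty {x : P // Λ.q x = Sum.inr e} := ⟨fun x => h1 h x.1 x.2⟩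
    simp
  · exact Finite.card_le_one_iff_subsingleton.2 hsub

/-- Presentations can be transported along isomorphisms. -/
def ofIso {P' : Type*} [PartialOrder P'] (Λ : Labeling G P) (φ : P' ≃o P) : Labeling G P' where
  q x := Λ.q (φ x)
  c i := φ.symm (Λ.c i)
  q_c i := by simp
  eq_c x i h := by rw [← Λ.eq_c _ _ h]; simp
  chain x y h := by simpa using Λ.chain _ _ h
  of_le x y h := Λ.of_le _ _ (φ.monotone h)
  le_of x y h := φ.le_iff_le.1 (Λ.le_of _ _ h)
  thin e h := Λ.thin e fun x => by simpa using h (φ.symm x)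

theorem ofIso_len {P' : Type*} [PartialOrder P'] (Λ : Labeling G P) (φ : P' ≃o P) (e : E) :
    (Λ.ofIso φ).len e = Λ.len e :=
  Nat.card_congr (φ.toEquiv.subtypeEquiv fun _ => Iff.rfl)

/-- Describes a strand by the first cover and the upper end alone, so that two presentations of the
same poset can be compared. -/
theorem mem_strand_iff (Λ : Labeling G P) [Finite P] {x : P} {e : E} :
    Λ.q x = Sum.inr e ↔ Λ.first e ≤ x ∧ x < Λ.c (G.t e) := by
  constructor
  · intro h
    refine ⟨?_, Λ.lt_c h⟩
    rcases Λ.first_spec e with ⟨-, h1⟩ | ⟨-, h1⟩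
    · exact h1 _ h
    · exact absurd h (h1 _)
  · rintro ⟨h1, h2⟩
    rcases Λ.first_spec e with ⟨h, -⟩ | ⟨h, -⟩
    · rcases Λ.of_le _ _ h1 with h3 | h3
      · exact h3.symm.trans h
      · rw [h, G.hi_inr, ← Λ.c_le_iff] at h3
        exact absurd h2 h3.not_gt
    · exact absurd h2 (h ▸ h1).not_gt

theorem first_le_c_iff (Λ : Labeling G P) [Finite P] {e : E} {i : I} :
    Λ.first e ≤ Λ.c i ↔ G.t e ≤ i := by
  rw [Λ.le_c_iff]
  rcases Λ.first_spec e with ⟨h, -⟩ | ⟨h, -⟩ <;> simp [h]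

variable {I' : Type*} {E' : Type*} [LinearOrder I'] {G' : StrandGraph I' E'}

/-- A finite poset has at most one presentation, up to isomorphism of strand graphs. -/
theorem exists_equiv (Λ : Labeling G P) (Λ' : Labeling G' P) [Finite P] :
    ∃ (f : I ≃o I') (g : E ≃ E'), (∀ i, Λ'.c (f i) = Λ.c i) ∧
      (∀ e, G'.s (g e) = f (G.s e) ∧ G'.t (g e) = f (G.t e)) ∧ ∀ e, Λ'.len (g e) = Λ.len e := by
  have hrange : Set.range Λ.c = Set.range Λ'.c := Λ.red_eq_range.symm.trans Λ'.red_eq_range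
  have h1 : ∀ i, ∃ j, Λ'.c j = Λ.c i := fun i => hrange.le (Set.mem_range_self i)
  have h2 : ∀ j, ∃ i, Λ.c i = Λ'.c j := fun j => hrange.ge (Set.mem_range_self j)
  choose f hf using h1
  choose f' hf' using h2
  let F : I ≃o I' :=
    { toFun := f
      invFun := f'
      left_inv := fun i => Λ.c_injective (by rw [hf', hf])
      right_inv := fun j => Λ'.c_injective (by rw [hf, hf'])
      map_rel_iff' := fun {a b} => by
        rw [← Λ'.c_le_c]
        simp [hf] }
  have hF : ∀ i, Λ'.c (F i) = Λ.c i := hf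
  -- Vertices are the reducible elements and strands are the upper covers of vertices, both
  -- intrinsic to the poset.
  have h3 : ∀ e, ∃ e', G'.s e' = F (G.s e) ∧ Λ'.first e' = Λ.first e := fun e =>
    Λ'.exists_eq_first (by rw [hF]; exact Λ.c_covBy_first e)
  choose g hg hg' using h3
  have hbij : Function.Bijective g := by
    constructor
    · intro e e' h
      refine Λ.first_injective ?_ ?_
      · apply F.injective
        rw [← hg, ← hg, h]
      · rw [← hg', ← hg', h]
    · intro e'
      have h4 : Λ.c (F.symm (G'.s e')) ⋖ Λ'.first e' := by
        rw [← hF]; simpa using Λ'.c_covBy_first e'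
      obtain ⟨e, he, he'⟩ := Λ.exists_eq_first h4
      refine ⟨e, Λ'.first_injective ?_ ?_⟩
      · rw [hg, he]; simp
      · rw [hg', he']
  -- The upper end is the least vertex above the first cover.
  have ht : ∀ e, G'.t (g e) = F (G.t e) := by
    intro e
    have : ∀ i, G'.t (g e) ≤ F i ↔ F (G.t e) ≤ F i := by
      intro i
      rw [← Λ'.first_le_c_iff, hF, hg', Λ.first_le_c_iff]
      simp
    apply le_antisymm
    · exact (this _).2 le_rfl
    · have h := (this (F.symm (G'.t (g e)))).1 (by simp)
      simpa using h
  refine ⟨F, Equiv.ofBijective g hbij, hF, fun e => ⟨hg e, ht e⟩, fun e => ?_⟩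
  refine Nat.card_congr (Equiv.subtypeEquivRight fun x => ?_)
  rw [Λ'.mem_strand_iff, Λ.mem_strand_iff]
  simp only [Equiv.ofBijective_apply]
  rw [hg', ht, hF]

/-- Presentations can be transported along isomorphisms of strand graphs. -/
def relabel (Λ : Labeling G P) (f : I ≃o I') (g : E ≃ E')
    (h : ∀ e, G'.s (g e) = f (G.s e) ∧ G'.t (g e) = f (G.t e)) : Labeling G' P where
  q x := Sum.map f g (Λ.q x)
  c i := Λ.c (f.symm i)
  q_c i := by simp
  eq_c x i hx := by
    cases hq : Λ.q x with
    | inl j =>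
      rw [hq] at hx
      rw [← (Sum.inl.inj hx : f j = i)]
      simpa using Λ.eq_c _ _ hq
    | inr e => rw [hq] at hx; simp at hx
  chain x y hxy := Λ.chain x y
    ((Sum.map_injective.2 ⟨f.injective, g.injective⟩) hxy)
  of_le x y hxy := by
    rcases Λ.of_le x y hxy with h1 | h1
    · left; rw [h1]
    · right
      cases hx : Λ.q x <;> cases hy : Λ.q y <;> rw [hx, hy] at h1 <;>
        simpa [h] using h1
  le_of x y hxy := by
    refine Λ.le_of x y ?_
    cases hx : Λ.q x <;> cases hy : Λ.q y <;> rw [hx, hy] at hxy <;>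
        simpa [h] using hxy
  thin e' he' := by
    obtain ⟨e, rfl⟩ := g.surjective e'
    have := Λ.thin e fun x hx => he' x (by rw [hx]; rfl)
    refine ⟨?_, fun e2 hs ht => ?_⟩
    · rw [(h e).1, (h e).2]; simpa using this.1
    · obtain ⟨e2, rfl⟩ := g.surjective e2
      rw [(h _).1, (h _).1] at hs
      rw [(h _).2, (h _).2] at ht
      rw [this.2 e2 (f.injective hs) (f.injective ht)]

theorem relabel_len (Λ : Labeling G P) (f : I ≃o I') (g : E ≃ E')
    (h : ∀ e, G'.s (g e) = f (G.s e) ∧ G'.t (g e) = f (G.t e)) (e : E) :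
    (Λ.relabel f g h).len (g e) = Λ.len e := by
  refine Nat.card_congr (Equiv.subtypeEquivRight fun x => ?_)
  show Sum.map f g (Λ.q x) = Sum.inr (g e) ↔ _
  cases Λ.q x <;> simp

theorem _root_.RCLattice.nonempty_orderIso_of_card_eq {α β : Type*} [PartialOrder α]
    [PartialOrder β] [Finite α] [Finite β] (hα : ∀ x y : α, x ≤ y ∨ y ≤ x)
    (hβ : ∀ x y : β, x ≤ y ∨ y ≤ x) (h : Nat.card α = Nat.card β) : Nonempty (α ≃o β) := by
  classical
  let _ : LinearOrder α := { (inferInstance : PartialOrder α) with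
    le_total := hα
    toDecidableLE := Classical.decRel _ }
  let _ : LinearOrder β := { (inferInstance : PartialOrder β) with
    le_total := hβ
    toDecidableLE := Classical.decRel _ }
  have := Fintype.ofFinite α
  have := Fintype.ofFinite β
  rw [Nat.card_eq_fintype_card, Nat.card_eq_fintype_card] at h
  exact ⟨(Fintype.orderIsoFinOfCardEq α h).symm.trans (Fintype.orderIsoFinOfCardEq β rfl)⟩

/-- Corresponding strands are chains of equal size, hence uniquely isomorphic; the order between
different parts is dictated by the graph, so the pieces glue. -/
theorem nonempty_orderIso {P' : Type*} [PartialOrder P'] [Finite P] [Finite P']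
    (Λ : Labeling G P) (Λ' : Labeling G P') (h : ∀ e, Λ.len e = Λ'.len e) :
    Nonempty (P ≃o P') := by
  have key : ∀ v, Nonempty ({x // Λ.q x = v} ≃o {x // Λ'.q x = v}) := by
    intro v
    refine nonempty_orderIso_of_card_eq (fun x y => Λ.chain _ _ (x.2.trans y.2.symm))
      (fun x y => Λ'.chain _ _ (x.2.trans y.2.symm)) ?_
    cases v with
    | inl i =>
      have h1 : Nat.card {x // Λ.q x = Sum.inl i} = 1 :=
        Nat.card_eq_one_iff_exists.2 ⟨⟨Λ.c i, by simp⟩, fun y => Subtype.ext (Λ.eq_c _ _ y.2)⟩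
      have h2 : Nat.card {x // Λ'.q x = Sum.inl i} = 1 :=
        Nat.card_eq_one_iff_exists.2 ⟨⟨Λ'.c i, by simp⟩, fun y => Subtype.ext (Λ'.eq_c _ _ y.2)⟩
      rw [h1, h2]
    | inr e => exact h e
  have φ := fun v => (key v).some
  let ψ : P ≃ P' := (Equiv.sigmaFiberEquiv Λ.q).symm.trans
    ((Equiv.sigmaCongrRight fun v => (φ v).toEquiv).trans (Equiv.sigmaFiberEquiv Λ'.q))
  have hψ : ∀ v x (hx : Λ.q x = v), ψ x = (φ v ⟨x, hx⟩).1 := by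
    rintro _ x rfl
    rfl
  have hq : ∀ x, Λ'.q (ψ x) = Λ.q x := fun x => (φ (Λ.q x) ⟨x, rfl⟩).2
  have hfib : ∀ v x y (hx : Λ.q x = v) (hy : Λ.q y = v), ψ x ≤ ψ y ↔ x ≤ y := by
    intro v x y hx hy
    rw [hψ v x hx, hψ v y hy, Subtype.coe_le_coe, (φ v).le_iff_le]
    rfl
  refine ⟨⟨ψ, ?_⟩⟩
  intro x y
  constructor
  · intro h
    rcases Λ'.of_le _ _ h with h1 | h1
    · rw [hq, hq] at h1
      exact (hfib _ x y h1 rfl).1 h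
    · rw [hq, hq] at h1
      exact Λ.le_of _ _ h1
  · intro h
    rcases Λ.of_le _ _ h with h1 | h1
    · exact (hfib _ x y h1 rfl).2 h
    · exact Λ'.le_of _ _ (by rwa [hq, hq])

end Labeling

/-! ### Existence of presentations -/

section Presentation

variable {P : Type w} [PartialOrder P]

/-- Climb from a common lower bound. While the current element is irreducible, its unique upper
cover stays below both; the climb ends at `a`, at `b` or at a reducible element. -/
theorem le_total_or_exists_red_ge [Finite P] {a b : P} (x : P) (ha : x ≤ a) (hb : x ≤ b) :
    (a ≤ b ∨ b ≤ a) ∨ ∃ v ∈ Red P, x ≤ v ∧ v ≤ a ∧ v ≤ b := by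
  induction x using WellFoundedGT.induction with
  | _ x ih =>
    by_cases hx : x ∈ Red P
    · exact Or.inr ⟨x, hx, le_rfl, ha, hb⟩
    · rcases ha.eq_or_lt with rfl | ha
      · exact Or.inl (Or.inl hb)
      rcases hb.eq_or_lt with rfl | hb
      · exact Or.inl (Or.inr ha.le)
      obtain ⟨y, hy, hya⟩ := ha.exists_covby_le
      obtain ⟨z, hz, hzb⟩ := hb.exists_covby_le
      obtain rfl : y = z := (not_not.1 hx).2 hy hz
      rcases ih y hy.lt hya hzb with h | ⟨v, h1, h2, h3⟩
      · exact Or.inl h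
      · exact Or.inr ⟨v, h1, hy.le.trans h2, h3⟩

theorem le_total_or_exists_red_le [Finite P] {a b : P} (x : P) (ha : a ≤ x) (hb : b ≤ x) :
    (a ≤ b ∨ b ≤ a) ∨ ∃ v ∈ Red P, v ≤ x ∧ a ≤ v ∧ b ≤ v := by
  induction x using WellFoundedLT.induction with
  | _ x ih =>
    by_cases hx : x ∈ Red P
    · exact Or.inr ⟨x, hx, le_rfl, ha, hb⟩
    · rcases ha.eq_or_lt with rfl | ha
      · exact Or.inl (Or.inr hb)
      rcases hb.eq_or_lt with rfl | hb
      · exact Or.inl (Or.inl ha.le)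
      obtain ⟨y, hya, hy⟩ := ha.exists_le_covby
      obtain ⟨z, hzb, hz⟩ := hb.exists_le_covby
      obtain rfl : y = z := (not_not.1 hx).1 hy hz
      rcases ih y hy.lt hya hzb with h | ⟨v, h1, h2, h3⟩
      · exact Or.inl h
      · exact Or.inr ⟨v, h1, h2.trans hy.le, h3⟩

theorem exists_labeling [Finite P] {I : Type u} [LinearOrder I] (c : I ↪o P)
    (hc : Set.range c = Red P) (hirr : ∀ x ∈ Irr P, (∃ y, y ⋖ x) ∧ ∃ y, x ⋖ y) :
    ∃ (E : Type (max u w)) (G : StrandGraph I E), Nonempty (Labeling G P) := by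
  classical
  have hfin : Finite I := Finite.of_injective _ c.injective
  have hred : ∀ {v}, v ∈ Red P → ∃ i, c i = v := fun {v} h => by rwa [← hc] at h
  have hcred : ∀ i, c i ∈ Red P := fun i => hc ▸ Set.mem_range_self i
  have hlow : ∀ x, ∃ i, c i ≤ x := by
    intro x
    induction x using WellFoundedLT.induction with
    | _ x ih =>
      by_cases hx : x ∈ Red P
      · obtain ⟨i, rfl⟩ := hred hx
        exact ⟨i, le_rfl⟩
      · obtain ⟨y, hy⟩ := (hirr x (not_not.1 hx)).1
        obtain ⟨i, hi⟩ := ih y hy.lt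
        exact ⟨i, hi.trans hy.le⟩
  have hupp : ∀ x, ∃ i, x ≤ c i := by
    intro x
    induction x using WellFoundedGT.induction with
    | _ x ih =>
      by_cases hx : x ∈ Red P
      · obtain ⟨i, rfl⟩ := hred hx
        exact ⟨i, le_rfl⟩
      · obtain ⟨y, hy⟩ := (hirr x (not_not.1 hx)).2
        obtain ⟨i, hi⟩ := ih y hy.lt
        exact ⟨i, hy.le.trans hi⟩
  have hlo : ∀ x, ∃ i, c i ≤ x ∧ ∀ j, c j ≤ x → j ≤ i := fun x => by
    obtain ⟨i, hi, h⟩ := Set.exists_max_image {i | c i ≤ x} id (Set.toFinite _) (hlow x)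
    exact ⟨i, hi, h⟩
  have hhi : ∀ x, ∃ i, x ≤ c i ∧ ∀ j, x ≤ c j → i ≤ j := fun x => by
    obtain ⟨i, hi, h⟩ := Set.exists_min_image {i | x ≤ c i} id (Set.toFinite _) (hupp x)
    exact ⟨i, hi, h⟩
  choose lo hlo hlo' using hlo
  choose hi hhi hhi' using hhi
  have lo_c : ∀ i, lo (c i) = i := fun i =>
    le_antisymm (by simpa using hlo (c i)) (hlo' _ _ le_rfl)
  have hi_c : ∀ i, hi (c i) = i := fun i =>
    le_antisymm (hhi' _ _ le_rfl) (by simpa using hhi (c i))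
  have lo_lt : ∀ x, x ∉ Red P → c (lo x) < x := fun x hx =>
    (hlo x).lt_of_ne fun h => hx (h ▸ hcred _)
  have hfst : ∀ x, ∃ u, x ∉ Red P → c (lo x) ⋖ u ∧ u ≤ x := by
    intro x
    by_cases hx : x ∈ Red P
    · exact ⟨x, fun h => absurd hx h⟩
    · obtain ⟨u, hu⟩ := (lo_lt x hx).exists_covby_le
      exact ⟨u, fun _ => hu⟩
  choose fst hfst using hfst
  -- The climb from `fst x` to `x` meets no vertex, since a vertex below `x` is at most `c (lo x)`.
  -- So both see the same next vertex.
  have hi_fst : ∀ x, x ∉ Red P → hi (fst x) = hi x := by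
    intro x hx
    obtain ⟨h1, h2⟩ := hfst x hx
    refine le_antisymm (hhi' _ _ (h2.trans (hhi x))) ?_
    rcases le_total_or_exists_red_ge (fst x) h2 (hhi (fst x)) with (h | h) | ⟨v, hv, h3, h4, h5⟩
    · exact hhi' _ _ h
    · exact absurd h1.lt ((hhi (fst x)).trans (c.monotone (hlo' _ _ h))).not_gt
    · obtain ⟨j, rfl⟩ := hred hv
      exact absurd h1.lt (h3.trans (c.monotone (hlo' _ _ h4))).not_gt
  have covBy_inj : ∀ i y z, c i ⋖ y → c i ⋖ z → y ≤ z ∨ z ≤ y → y = z := by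
    rintro i y z hy hz (h | h)
    · exact (hz.eq_or_eq hy.le h).resolve_left hy.lt.ne'
    · exact ((hy.eq_or_eq hz.le h).resolve_left hz.lt.ne').symm
  let edge : ∀ i u, c i ⋖ u → {p : I × P // c p.1 ⋖ p.2} := fun i u h => ⟨(i, u), h⟩
  have edge_inj : ∀ {i u h j v h'}, edge i u h = edge j v h' → i = j ∧ u = v := by
    intro i u h j v h' heq
    simpa [edge] using heq
  -- A strand is encoded by its lower vertex together with an upper cover of it; its upper end is
  -- the next vertex above that cover.
  let G : StrandGraph I {p : I × P // c p.1 ⋖ p.2} :=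
    { s := fun e => e.1.1
      t := fun e => hi e.1.2
      lt := fun e => by
        rw [← c.lt_iff_lt]
        exact e.2.lt.trans_le (hhi _)
      exists_of_covBy := fun i j hij => by
        obtain ⟨u, hu, huj⟩ := (c.strictMono hij.lt).exists_covby_le
        refine ⟨edge i u hu, rfl, ?_⟩
        refine (hij.eq_or_eq ?_ (hhi' u j huj)).resolve_left ?_
        · rw [← c.le_iff_le]
          exact hu.le.trans (hhi u)
        · intro h
          have := hhi u
          rw [show hi u = i from h] at this
          exact hu.lt.not_ge this
      branching := fun i => by
        have hi' : ¬ (_ ∧ _) := hcred i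
        rw [not_and_or, Set.not_subsingleton_iff, Set.not_subsingleton_iff] at hi'
        rcases hi' with ⟨w, hw, w', hw', hne⟩ | ⟨u, hu, u', hu', hne⟩
        · right
          replace hw : w ⋖ c i := hw
          replace hw' : w' ⋖ c i := hw'
          have hi_w : ∀ w, w ⋖ c i → w ∉ Red P → hi w = i := by
            intro w hw hR
            rcases hw.eq_or_eq (hhi w) (c.monotone (hhi' w i hw.le)) with h | h
            · exact absurd (h ▸ hcred _) hR
            · exact c.injective h
          have hne' : ¬ (w ≤ w' ∨ w' ≤ w) := by
            rintro (h | h)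
            · exact ((hw.eq_or_eq h hw'.le).resolve_right hw'.lt.ne) |> fun h => hne h.symm
            · exact hne ((hw'.eq_or_eq h hw.le).resolve_right hw.lt.ne)
          -- Each lower cover of `c i` selects a strand ending at `i`. Two covers selecting the same
          -- one would share a lower bound with no vertex in between, hence be comparable.
          have key : ∀ w, w ⋖ c i → ∃ e : {p : I × P // c p.1 ⋖ p.2}, hi e.1.2 = i ∧
              ((w ∈ Red P ∧ e.1.2 = c i ∧ c e.1.1 = w) ∨ (w ∉ Red P ∧ e.1.2 ≤ w ∧
                e.1.1 = lo w)) := by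
            intro w hw
            by_cases hR : w ∈ Red P
            · obtain ⟨j, rfl⟩ := hred hR
              exact ⟨edge j (c i) hw, hi_c i, Or.inl ⟨hR, rfl, rfl⟩⟩
            · exact ⟨edge _ _ (hfst w hR).1, (hi_fst w hR).trans (hi_w w hw hR),
                Or.inr ⟨hR, (hfst w hR).2, rfl⟩⟩
          obtain ⟨e, he, h1⟩ := key w hw
          obtain ⟨e', he', h2⟩ := key w' hw'
          refine ⟨e, e', ?_, he, he'⟩
          rintro rfl
          rcases h1 with ⟨h1, h3, h5⟩ | ⟨h1, h3, h5⟩ <;> rcases h2 with ⟨h2, h4, h6⟩ | ⟨h2, h4, h6⟩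
          · exact hne (h5.symm.trans h6)
          · exact absurd (h3 ▸ h4) hw'.lt.not_ge
          · exact absurd (h4 ▸ h3) hw.lt.not_ge
          · rcases le_total_or_exists_red_ge _ h3 h4 with h | ⟨v, hv, h7, h8, h9⟩
            · exact hne' h
            · obtain ⟨j, rfl⟩ := hred hv
              have := c.monotone (hlo' _ _ h8)
              rw [← h5] at this
              exact e.2.lt.not_ge (h7.trans this)
        · left
          exact ⟨edge i u hu, edge i u' hu', fun h => hne (edge_inj h).2, rfl, rfl⟩ }
  let q : P → I ⊕ {p : I × P // c p.1 ⋖ p.2} := fun x =>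
    if hx : x ∈ Red P then Sum.inl (lo x) else Sum.inr (edge _ _ (hfst x hx).1)
  have q_red : ∀ x (hx : x ∈ Red P), q x = Sum.inl (lo x) := fun x hx => dif_pos hx
  have q_irr : ∀ x (hx : x ∉ Red P), q x = Sum.inr (edge _ _ (hfst x hx).1) :=
    fun x hx => dif_neg hx
  have q_lo : ∀ x, G.lo (q x) = lo x := by
    intro x
    by_cases hx : x ∈ Red P
    · rw [q_red x hx]; rfl
    · rw [q_irr x hx]; rfl
  have q_hi : ∀ x, G.hi (q x) = hi x := by
    intro x
    by_cases hx : x ∈ Red P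
    · rw [q_red x hx]
      obtain ⟨i, rfl⟩ := hred hx
      rw [G.hi_inl, lo_c, hi_c]
    · rw [q_irr x hx]
      exact hi_fst x hx
  refine ⟨{p : I × P // c p.1 ⋖ p.2}, G, ⟨⟨q, c, ?_, ?_, ?_, ?_, ?_, ?_⟩⟩⟩
  · intro i
    rw [q_red _ (hcred i), lo_c]
  · intro x i h
    by_cases hx : x ∈ Red P
    · rw [q_red x hx] at h
      obtain ⟨j, rfl⟩ := hred hx
      rw [lo_c] at h
      rw [Sum.inl.inj h]
    · rw [q_irr x hx] at h; cases h
  · intro x y h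
    by_cases hx : x ∈ Red P <;> by_cases hy : y ∈ Red P
    · rw [q_red x hx, q_red y hy] at h
      obtain ⟨i, rfl⟩ := hred hx
      obtain ⟨j, rfl⟩ := hred hy
      rw [lo_c, lo_c] at h
      rw [Sum.inl.inj h]
      exact Or.inl le_rfl
    · rw [q_red x hx, q_irr y hy] at h; cases h
    · rw [q_irr x hx, q_red y hy] at h; cases h
    · rw [q_irr x hx, q_irr y hy] at h
      obtain ⟨h1, h2⟩ := edge_inj (Sum.inr.inj h)
      rcases le_total_or_exists_red_ge (fst x) (hfst x hx).2 (h2 ▸ (hfst y hy).2) with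
        h | ⟨v, hv, h3, h4, h5⟩
      · exact h
      · obtain ⟨j, rfl⟩ := hred hv
        exact absurd (h3.trans (c.monotone (hlo' _ _ h4))) (hfst x hx).1.lt.not_ge
  · intro x y hxy
    rw [q_lo, q_hi]
    by_cases hj : ∃ j, x ≤ c j ∧ c j ≤ y
    · obtain ⟨j, h1, h2⟩ := hj
      exact Or.inr ((hhi' _ _ h1).trans (hlo' _ _ h2))
    · left
      push Not at hj
      have hx : x ∉ Red P := fun h => by
        obtain ⟨i, rfl⟩ := hred h
        exact hj i le_rfl hxy
      have hy : y ∉ Red P := fun h => by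
        obtain ⟨i, rfl⟩ := hred h
        exact hj i hxy le_rfl
      have hl : lo x = lo y := by
        refine le_antisymm (hlo' _ _ ((hlo x).trans hxy)) ?_
        rcases le_total_or_exists_red_le y hxy (hlo y) with (h | h) | ⟨v, hv, h1, h2, h3⟩
        · exact absurd (hlo y) (hj _ h)
        · exact hlo' _ _ h
        · obtain ⟨j, rfl⟩ := hred hv
          exact absurd h1 (hj _ h2)
      have hf : fst x = fst y := by
        refine covBy_inj (lo x) _ _ (hfst x hx).1 (hl ▸ (hfst y hy).1) ?_
        rcases le_total_or_exists_red_le y ((hfst x hx).2.trans hxy) (hfst y hy).2 with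
          h | ⟨v, hv, h1, h2, h3⟩
        · exact h
        · obtain ⟨j, rfl⟩ := hred hv
          exact absurd (h3.trans (c.monotone (hlo' _ _ h1))) (hfst y hy).1.lt.not_ge
      rw [q_irr x hx, q_irr y hy]
      simp [edge, hl, hf]
  · intro x y h
    rw [q_lo, q_hi] at h
    exact (hhi x).trans ((c.monotone h).trans (hlo y))
  · rintro ⟨⟨i, u⟩, hu⟩ he
    replace hu : c i ⋖ u := hu
    -- An irreducible `u` would lie on the strand `(i, u)`, which is empty. So `u` is the next
    -- vertex, and any parallel strand has its first cover below `u`, hence equal to `u`.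
    have huR : u ∈ Red P := by
      by_contra huR
      apply he u
      rw [q_irr u huR]
      have h1 : lo u = i := by
        rcases hu.eq_or_eq (c.monotone (hlo' _ _ hu.le)) (hlo u) with h | h
        · exact c.injective h
        · exact absurd (h ▸ hcred _) huR
      have h2 : fst u = u :=
        covBy_inj i _ _ (h1 ▸ (hfst u huR).1) hu (Or.inl (hfst u huR).2)
      simp [edge, h1, h2]
    obtain ⟨j, rfl⟩ := hred huR
    refine ⟨?_, ?_⟩
    · show i ⋖ hi (c j)
      rw [hi_c]
      exact ⟨by simpa using hu.lt, fun k h1 h2 => hu.2 (c := c k) (by simpa) (by simpa)⟩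
    · rintro ⟨⟨i', u'⟩, hu'⟩ hs ht
      obtain rfl : i' = i := hs
      replace ht : hi u' = hi (c j) := ht
      have h1 : u' ≤ c j := by
        have := hhi u'
        rwa [ht, hi_c] at this
      have h2 : u' = c j := covBy_inj i' _ _ hu' hu (Or.inl h1)
      simp [h2]

end Presentation

/-! ### Presented posets are blocks, and blocks are presented -/

section Lattice

variable {I : Type u} {E : Type v} [LinearOrder I] {G : StrandGraph I E}

namespace Labeling

variable {P : Type w}

/-- Incomparable elements lie on parts that only meet again at vertices, so their common upper
bounds all lie above the larger of the two upper ends. -/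
theorem exists_isLUB [PartialOrder P] (Λ : Labeling G P) (x y : P) :
    ∃ z, IsLUB {x, y} z := by
  by_cases hxy : x ≤ y ∨ y ≤ x
  · rcases hxy with h | h
    · exact ⟨y, by simp [IsLUB, IsLeast, upperBounds, lowerBounds, h]⟩
    · exact ⟨x, by simp +contextual [IsLUB, IsLeast, upperBounds, lowerBounds, h]⟩
  · push Not at hxy
    refine ⟨Λ.c (max (G.hi (Λ.q x)) (G.hi (Λ.q y))), ?_, ?_⟩
    · simp [upperBounds, Λ.le_c_iff]
    · intro z hz
      simp only [upperBounds, Set.mem_insert_iff, Set.mem_singleton_iff, forall_eq_or_imp,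
        forall_eq, Set.mem_ofPred_eq] at hz
      rw [Λ.c_le_iff]
      rcases Λ.of_le _ _ hz.1 with h1 | h1 <;> rcases Λ.of_le _ _ hz.2 with h2 | h2
      · exact absurd (Λ.chain x y (h1.trans h2.symm)) (not_or.2 hxy)
      · rw [← h1] at h2
        exact absurd (Λ.le_of _ _ h2) hxy.2
      · rw [← h2] at h1
        exact absurd (Λ.le_of _ _ h1) hxy.1
      · exact max_le h1 h2

theorem exists_isGLB [PartialOrder P] (Λ : Labeling G P) (x y : P) :
    ∃ z, IsGLB {x, y} z :=
  let ⟨z, hz⟩ := Λ.dual.exists_isLUB (OrderDual.toDual x) (OrderDual.toDual y)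
  ⟨z.ofDual, hz⟩

theorem exists_lattice [inst : PartialOrder P] (Λ : Labeling G P) :
    ∃ L : Lattice P, L.toPartialOrder = inst := by
  choose sup hsup using Λ.exists_isLUB
  choose inf hinf using Λ.exists_isGLB
  refine ⟨{ inst with
    sup := sup
    inf := inf
    le_sup_left := fun x y => (hsup x y).1 (by simp)
    le_sup_right := fun x y => (hsup x y).1 (by simp)
    sup_le := fun x y z h h' => (hsup x y).2 (by simp [upperBounds, h, h'])
    inf_le_left := fun x y => (hinf x y).1 (by simp)
    inf_le_right := fun x y => (hinf x y).1 (by simp)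
    le_inf := fun x y z h h' => (hinf y z).2 (by simp [lowerBounds, h, h']) }, rfl⟩

theorem isBlock [Lattice P] (Λ : Labeling G P) [Finite P] [Nonempty I] : IsBlock P := by
  have := Λ.finite_vertices
  obtain ⟨m, hm⟩ := Finite.exists_max (id : I → I)
  obtain ⟨b, hb⟩ := Finite.exists_min (id : I → I)
  have htop : IsTop (Λ.c m) := fun x => Λ.le_c_iff.2 (hm _)
  have hbot : IsBot (Λ.c b) := fun x => Λ.c_le_iff.2 (hb _)
  constructor
  · refine ⟨_, htop, ?_⟩
    rcases Λ.two_covers m with ⟨y, -, -, hy, -⟩ | ⟨y, z, hne, hy, hz⟩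
    · exact absurd (htop y) hy.lt.not_ge
    · refine ⟨y, z, hy.lt.ne, hz.lt.ne, ?_⟩
      rcases hy.eq_or_eq le_sup_left (sup_le hy.le hz.le) with h | h
      · have : z ≤ y := sup_eq_left.1 h
        exact absurd ((hz.eq_or_eq this hy.le).resolve_right hy.lt.ne) hne
      · exact h
  · refine ⟨_, hbot, ?_⟩
    rcases Λ.two_covers b with ⟨y, z, hne, hy, hz⟩ | ⟨y, -, -, hy, -⟩
    · refine ⟨y, z, hy.lt.ne', hz.lt.ne', ?_⟩
      rcases hy.eq_or_eq (le_inf hy.le hz.le) inf_le_left with h | h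
      · exact h
      · have : y ≤ z := inf_eq_left.1 h
        exact absurd ((hz.eq_or_eq hy.le this).resolve_left hy.lt.ne') hne
    · exact absurd (hbot y) hy.lt.not_ge

theorem card_eq_sum [PartialOrder P] (Λ : Labeling G P) [Finite P] [Fintype E] :
    Nat.card P = Nat.card I + ∑ e, Λ.len e := by
  rw [Λ.card_eq_add]
  congr 1
  unfold len
  rw [← Nat.card_sigma]
  refine Nat.card_congr ?_
  refine Equiv.ofBijective (fun x => ⟨x.2.choose, x.1, x.2.choose_spec⟩) ⟨?_, ?_⟩
  · rintro ⟨x, hx⟩ ⟨y, hy⟩ h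
    have := congrArg (fun z : (Σ e, {x : P // Λ.q x = Sum.inr e}) => z.2.1) h
    exact Subtype.ext this
  · rintro ⟨e, x, hx⟩
    refine ⟨⟨x, e, hx⟩, ?_⟩
    have h : ∃ e, Λ.q x = Sum.inr e := ⟨e, hx⟩
    have he : h.choose = e := Sum.inr.inj (h.choose_spec.symm.trans hx)
    apply Sigma.ext he
    subst he
    rfl

end Labeling

/-- The least element has two upper covers and the greatest two lower ones, so an irreducible
element is neither. -/
theorem IsBlock.exists_covBy {L : Type w} [Lattice L] [Finite L] (hL : IsBlock L) {x : L}
    (hx : x ∈ Irr L) : (∃ y, y ⋖ x) ∧ ∃ y, x ⋖ y := by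
  obtain ⟨⟨t, ht, y, z, hy, hz, hyz⟩, ⟨b, hb, y', z', hy', hz', hyz'⟩⟩ := hL
  constructor
  · have hne : b ≠ x := by
      rintro rfl
      obtain ⟨u, hu, huy⟩ := ((hb y').lt_of_ne' hy').exists_covby_le
      obtain ⟨v, hv, hvz⟩ := ((hb z').lt_of_ne' hz').exists_covby_le
      obtain rfl := hx.2 hu hv
      have := le_inf huy hvz
      rw [hyz'] at this
      exact hu.lt.not_ge this
    obtain ⟨u, -, hu⟩ := ((hb x).lt_of_ne hne).exists_le_covby
    exact ⟨u, hu⟩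
  · have hne : x ≠ t := by
      rintro rfl
      obtain ⟨u, huy, hu⟩ := ((ht y).lt_of_ne hy).exists_le_covby
      obtain ⟨v, hvz, hv⟩ := ((ht z).lt_of_ne hz).exists_le_covby
      obtain rfl := hx.1 hu hv
      have := sup_le huy hvz
      rw [hyz] at this
      exact hu.lt.not_ge this
    obtain ⟨u, hu, -⟩ := ((ht x).lt_of_ne hne).exists_covby_le
    exact ⟨u, hu⟩

theorem IsBlock.exists_labeling {L : Type w} [Lattice L] [Finite L] (hL : IsBlock L)
    (hRC : IsRC L) {r : ℕ} (hr : (Red L).ncard = r) :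
    ∃ (E : Type w) (G : StrandGraph (Fin r) E), Nonempty (Labeling G L) := by
  have h1 : Nonempty (Fin r ≃o Red L) := by
    refine nonempty_orderIso_of_card_eq (fun x y => le_total x y) (fun x y => ?_) (by simp [hr])
    rcases eq_or_ne x y with h | h
    · exact Or.inl h.le
    · exact hRC x.2 y.2 (fun h' => h (Subtype.ext h'))
  obtain ⟨φ⟩ := h1
  refine RCLattice.exists_labeling (φ.toOrderEmbedding.trans (OrderEmbedding.subtype _)) ?_
    (fun x hx => hL.exists_covBy hx)
  ext x
  constructor
  · rintro ⟨i, rfl⟩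
    exact (φ i).2
  · intro hx
    exact ⟨φ.symm ⟨x, hx⟩, by simp⟩

namespace StrandGraph

/-- The poset that is presented by the graph `G`, with `ℓ e` elements on the strand `e`. -/
def Model (_ : StrandGraph I E) (ℓ : E → ℕ) : Type max u v := I ⊕ Σ e, Fin (ℓ e)

namespace Model

variable {ℓ : E → ℕ}

def q : G.Model ℓ → I ⊕ E := Sum.map id Sigma.fst

def pos : G.Model ℓ → ℕ := Sum.elim (fun _ => 0) fun x => x.2

theorem ext_q_pos {x y : G.Model ℓ} (h : q x = q y) (h' : pos x = pos y) : x = y := by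
  rcases x with i | ⟨e, a⟩ <;> rcases y with j | ⟨e', a'⟩
  · exact congrArg _ (Sum.inl.inj h)
  · cases h
  · cases h
  · obtain rfl : e = e' := Sum.inr.inj h
    obtain rfl : a = a' := Fin.ext h'
    rfl

theorem eq_of_hi_le_lo {x y : G.Model ℓ} (h : G.hi (q x) ≤ G.lo (q x)) (h' : q x = q y) :
    x = y := by
  rcases x with i | ⟨e, a⟩
  · rcases y with j | ⟨e', a'⟩
    · exact congrArg _ (Sum.inl.inj h')
    · cases h'
  · exact absurd h (G.lt e).not_ge

instance : PartialOrder (G.Model ℓ) where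
  le x y := (q x = q y ∧ pos x ≤ pos y) ∨ G.hi (q x) ≤ G.lo (q y)
  le_refl x := Or.inl ⟨rfl, le_rfl⟩
  le_trans x y z := by
    rintro (⟨h1, h2⟩ | h1) (⟨h3, h4⟩ | h3)
    · exact Or.inl ⟨h1.trans h3, h2.trans h4⟩
    · exact Or.inr (h1 ▸ h3)
    · exact Or.inr (h3 ▸ h1)
    · exact Or.inr (h1.trans ((G.lo_le_hi _).trans h3))
  le_antisymm x y := by
    rintro (⟨h1, h2⟩ | h1) (⟨h3, h4⟩ | h3)
    · exact ext_q_pos h1 (le_antisymm h2 h4)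
    · exact eq_of_hi_le_lo (by rwa [← h1] at h3) h1
    · exact eq_of_hi_le_lo (by rwa [h3] at h1) h3.symm
    · have h5 := h1.trans ((G.lo_le_hi _).trans h3)
      have h6 := h3.trans ((G.lo_le_hi _).trans h1)
      rcases x with i | ⟨e, a⟩
      · rcases y with j | ⟨e', a'⟩
        · exact congrArg _ (le_antisymm h1 h3)
        · exact absurd h6 (G.lt e').not_ge
      · exact absurd h5 (G.lt e).not_ge

def labeling (h : ∀ e, G.minLen e ≤ ℓ e) : Labeling G (G.Model ℓ) where
  q := q
  c i := Sum.inl i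
  q_c _ := rfl
  eq_c x i hx := by
    rcases x with j | x
    · exact congrArg _ (Sum.inl.inj hx)
    · cases hx
  chain x y hxy := by
    rcases le_total (pos x) (pos y) with h | h
    · exact Or.inl (Or.inl ⟨hxy, h⟩)
    · exact Or.inr (Or.inl ⟨hxy.symm, h⟩)
  of_le x y hxy := hxy.imp And.left id
  le_of x y hxy := Or.inr hxy
  thin e he := by
    by_contra hth
    have := h e
    rw [minLen, if_neg hth] at this
    exact he (Sum.inr ⟨e, ⟨0, this⟩⟩) rfl

theorem labeling_len (h : ∀ e, G.minLen e ≤ ℓ e) (e : E) : (labeling h).len e = ℓ e := by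
  have : Nat.card (Fin (ℓ e)) = ℓ e := by simp
  refine Eq.trans (Nat.card_congr ?_) this
  symm
  refine Equiv.ofBijective (fun a => ⟨Sum.inr ⟨e, a⟩, rfl⟩) ⟨?_, ?_⟩
  · intro a b hab
    simpa using Sum.inr.inj (Subtype.ext_iff.1 hab)
  · rintro ⟨i | ⟨e', a⟩, hx⟩
    · cases hx
    · obtain rfl : e' = e := Sum.inr.inj hx
      exact ⟨a, rfl⟩

end Model

/-- Every admissible length function is realised on any carrier of the right size. -/
theorem exists_lattice [Finite I] [Fintype E] (V : Type w) [Finite V] (ℓ : E → ℕ)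
    (h : ∀ e, G.minLen e ≤ ℓ e) (hcard : Nat.card V = Nat.card I + ∑ e, ℓ e) :
    ∃ (_ : Lattice V) (Λ : Labeling G V), ∀ e, Λ.len e = ℓ e := by
  -- Replaces the given order by the definitionally different order underlying the lattice.
  have key : ∀ (L : Lattice V) (i : PartialOrder V), L.toPartialOrder = i →
      (∃ Λ : Labeling G V, ∀ e, Λ.len e = ℓ e) →
      ∃ (K : Lattice V) (Λ : @Labeling I E _ G V K.toPartialOrder),
        ∀ e, @Labeling.len I E _ G V K.toPartialOrder Λ e = ℓ e := by
    rintro L _ rfl hΛ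
    exact ⟨L, hΛ⟩
  have hfin : Finite (G.Model ℓ) := inferInstanceAs (Finite (I ⊕ Σ e, Fin (ℓ e)))
  have h1 : Nat.card V = Nat.card (G.Model ℓ) := by
    rw [hcard, (Model.labeling h).card_eq_sum]
    simp [Model.labeling_len]
  obtain ⟨φ⟩ : Nonempty (V ≃ G.Model ℓ) := (Finite.card_eq).1 h1
  let inst : PartialOrder V := PartialOrder.lift φ φ.injective
  let ψ : V ≃o G.Model ℓ := ⟨φ, Iff.rfl⟩
  obtain ⟨L, hL⟩ := ((Model.labeling h).ofIso ψ).exists_lattice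
  exact key L inst hL ⟨(Model.labeling h).ofIso ψ, fun e => by
    rw [Labeling.ofIso_len, Model.labeling_len]⟩

end StrandGraph

end Lattice

/-! ### The associated basic block is determined by the strand graph -/

section Association

variable {I : Type u} {E : Type v} [LinearOrder I] {G : StrandGraph I E}

theorem IsBasicBlock.isBlock {B : Type w} [Lattice B] (hB : IsBasicBlock B)
    (hcard : Nat.card B ≠ 1) : IsBlock B :=
  (hB.resolve_left hcard).1

/-- Deleting a retractible element keeps the strand graph, hence the nullity, whereas in a basic
block each deletion lowers it. -/
theorem IsBasicBlock.isBasicRetract {B : Type w} [Lattice B] [Finite B] [Nonempty I]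
    (hB : IsBasicBlock B) (hcard : Nat.card B ≠ 1) (Λ : Labeling G B) : IsBasicRetract B := by
  intro x hx hr
  have hirr := Labeling.irrStar_subset hx
  rcases (hB.resolve_left hcard).2 with h | h
  · exact absurd hirr (h ▸ Set.notMem_empty x)
  · have h1 := h x hirr
    obtain ⟨Λ'⟩ := Λ.erase (OrderEmbedding.subtype fun y => y ≠ x) x (by simp) hx hr
    rw [Λ.nullity_eq, Λ'.nullity_eq] at h1
    linarith

theorem RetractStep.nonempty_labeling {P : Type w} [PartialOrder P] [Finite P] {S T : Set P}
    (h : RetractStep S T) (Λ : Labeling G S) : Nonempty (Labeling G T) := by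
  obtain ⟨x, hx, hr, rfl⟩ := h
  refine Λ.erase
    ⟨⟨Set.inclusion Set.sdiff_subset, Set.inclusion_injective Set.sdiff_subset⟩, Iff.rfl⟩
    x ?_ hx hr
  intro y
  constructor
  · rintro ⟨z, rfl⟩ h
    exact z.2.2 (congrArg Subtype.val h)
  · intro hy
    exact ⟨⟨y.1, y.2, fun h => hy (Subtype.ext h)⟩, rfl⟩

theorem RetractStep.ssubset {P : Type w} [PartialOrder P] {S T : Set P}
    (h : RetractStep S T) : T ⊂ S := by
  obtain ⟨x, -, -, rfl⟩ := h
  exact ⟨Set.sdiff_subset, fun h => (h x.2).2 rfl⟩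

theorem nonempty_labeling_of_reflTransGen {P : Type w} [PartialOrder P] [Finite P] {S T : Set P}
    (h : Relation.ReflTransGen RetractStep S T) (Λ : Labeling G S) : Nonempty (Labeling G T) := by
  induction h with
  | refl => exact ⟨Λ⟩
  | tail _ h ih =>
    obtain ⟨Λ'⟩ := ih
    exact h.nonempty_labeling Λ'

theorem exists_isBasicRetract {P : Type w} [PartialOrder P] [Finite P] (S : Set P) :
    ∃ R : Set P, Relation.ReflTransGen RetractStep S R ∧ IsBasicRetract R := by
  induction S using WellFoundedLT.induction with
  | _ S ih =>
    by_cases h : IsBasicRetract S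
    · exact ⟨S, .refl, h⟩
    · unfold IsBasicRetract at h
      push Not at h
      obtain ⟨x, hx, hr⟩ := h
      have hstep : RetractStep S (S \ {x.1}) := ⟨x, hx, hr, rfl⟩
      obtain ⟨R, h1, h2⟩ := ih _ hstep.ssubset
      exact ⟨R, .head hstep h1, h2⟩

theorem Labeling.isBasicBlockAssociatedTo_iff {P B : Type*} [PartialOrder P] [PartialOrder B]
    [Finite P] [Finite B] (Λ : Labeling G P) (hB : IsBasicRetract B) :
    IsBasicBlockAssociatedTo B P ↔ Nonempty (Labeling G B) := by
  have Λ₀ : Labeling G (Set.univ : Set P) := Λ.ofIso OrderIso.Set.univ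
  constructor
  · rintro ⟨R, T, h1, hR, h2, -, -, ⟨φ⟩⟩
    obtain ⟨ΛR⟩ := nonempty_labeling_of_reflTransGen h1 Λ₀
    -- The second phase is empty: a presented poset has no pendant vertex and `R` is already a basic
    -- retract.
    have : R = T := by
      rcases h2.cases_head with h | ⟨S, ⟨x, hx, -⟩ | ⟨x, hx, hr, -⟩, -⟩
      · exact h
      · exact absurd hx (ΛR.not_isPendant x)
      · exact absurd hr (hR x hx)
    subst this
    exact ⟨ΛR.ofIso φ⟩
  · rintro ⟨ΛB⟩
    obtain ⟨R, h1, hR⟩ := exists_isBasicRetract (Set.univ : Set P)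
    obtain ⟨ΛR⟩ := nonempty_labeling_of_reflTransGen h1 Λ₀
    refine ⟨R, R, h1, hR, .refl, ΛR.not_isPendant, hR, ?_⟩
    exact ΛB.nonempty_orderIso ΛR fun e => by rw [ΛB.len_eq_minLen hB, ΛR.len_eq_minLen hR]

/-- A block with these data has some strand graph on `Fin r`; association transfers this graph to
`B`, and uniqueness of presentations identifies it with `G`. -/
theorem mem_blocksOn_iff {V : Type*} [Finite V] {B : Type*} [PartialOrder B] [Finite B] {k r : ℕ}
    [NeZero r] {G : StrandGraph (Fin r) E} (ΛB : Labeling G B) (hB : IsBasicRetract B)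
    (hk : nullity B = k) (L : Lattice V) :
    L ∈ blocksOn V B k r ↔ Nonempty (Labeling G V) := by
  constructor
  · rintro ⟨h1, h2, h3, h4, h5⟩
    obtain ⟨E', G', ⟨Λ⟩⟩ := h1.exists_labeling h2 h4
    obtain ⟨ΛB'⟩ := (Λ.isBasicBlockAssociatedTo_iff hB).1 h5
    obtain ⟨f, g, -, hg, -⟩ := ΛB'.exists_equiv ΛB
    exact ⟨Λ.relabel f g hg⟩
  · rintro ⟨Λ⟩
    refine ⟨Λ.isBlock, Λ.isRC, ?_, ?_, (Λ.isBasicBlockAssociatedTo_iff hB).2 ⟨ΛB⟩⟩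
    · rw [Λ.nullity_eq, ← hk, ΛB.nullity_eq]
    · rw [Λ.ncard_red]; simp

theorem Labeling.nonempty_orderIso_iff {P P' : Type*} [PartialOrder P] [PartialOrder P'] [Finite P]
    [Finite P'] [Finite I] (Λ : Labeling G P) (Λ' : Labeling G P') :
    Nonempty (P ≃o P') ↔ ∃ σ : E ≃ E, (∀ e, G.s (σ e) = G.s e ∧ G.t (σ e) = G.t e) ∧
      ∀ e, Λ'.len (σ e) = Λ.len e := by
  constructor
  · rintro ⟨φ⟩
    obtain ⟨f, g, -, hg, hlen⟩ := Λ.exists_equiv (Λ'.ofIso φ)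
    -- A finite chain has no nontrivial automorphism.
    obtain rfl : f = OrderIso.refl I := Subsingleton.elim _ _
    exact ⟨g, hg, fun e => by rw [← hlen, Labeling.ofIso_len]⟩
  · rintro ⟨σ, h1, h2⟩
    refine (Λ.relabel (OrderIso.refl I) σ h1).nonempty_orderIso Λ' fun e => ?_
    obtain ⟨e, rfl⟩ := σ.surjective e
    exact (Λ.relabel_len (OrderIso.refl I) σ h1 e).trans (h2 e).symm

end Association

/-! ### Counting length functions up to permutation of parallel strands -/

section Counting

theorem ncard_image_mk_eq_card {α β : Type*} (s : Setoid α) (S : Set α) (f : S → β)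
    (hf : Function.Surjective f) (hr : ∀ x y : S, f x = f y ↔ s.r x.1 y.1) :
    (Quotient.mk s '' S).ncard = Nat.card β := by
  rw [← Nat.card_coe_set_eq]
  symm
  choose g hg using hf
  refine Nat.card_congr (Equiv.ofBijective
    (fun b => ⟨Quotient.mk s (g b), Set.mem_image_of_mem _ (g b).2⟩) ⟨?_, ?_⟩)
  · intro a b h
    have h1 : s.r (g a).1 (g b).1 := Quotient.exact (Subtype.ext_iff.1 h)
    rw [← hg a, ← hg b, (hr _ _).2 h1]
  · rintro ⟨_, x, hx, rfl⟩
    refine ⟨f ⟨x, hx⟩, Subtype.ext (Quotient.sound ?_)⟩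
    exact (hr (g (f ⟨x, hx⟩)) ⟨x, hx⟩).1 (hg _)

theorem exists_equiv_of_card_fiber_eq {α β : Type*} [Finite α] (f g : α → β)
    (h : ∀ b, Nat.card {a // f a = b} = Nat.card {a // g a = b}) :
    ∃ σ : α ≃ α, ∀ a, g (σ a) = f a := by
  have φ := fun b => (Finite.card_eq.1 (h b)).some
  refine ⟨(Equiv.sigmaFiberEquiv f).symm.trans
    ((Equiv.sigmaCongrRight φ).trans (Equiv.sigmaFiberEquiv g)), fun a => ?_⟩
  exact (φ (f a) ⟨a, rfl⟩).2

theorem exists_map_univ_eq {α β : Type*} [Fintype α] (M : Multiset β)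
    (h : Multiset.card M = Fintype.card α) :
    ∃ f : α → β, (Finset.univ : Finset α).val.map f = M := by
  induction M using Quotient.inductionOn with
  | _ l =>
    have h' : Fintype.card α = l.length := h.symm
    refine ⟨fun a => l.get (Fintype.equivFinOfCardEq h' a), ?_⟩
    have : (Finset.univ : Finset α).val.map (Fintype.equivFinOfCardEq h') =
        (Finset.univ : Finset (Fin l.length)).val := Multiset.map_univ_val_equiv _
    rw [← Function.comp_def, ← Multiset.map_map, this]
    simp

open Classical in
/-- The multisets of the values of `ℓ` on the fibres of `π`. -/
noncomputable def fiberValues {E Q : Type*} [Fintype E] (π : E → Q) (ℓ : E → ℕ) (κ : Q) :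
    Multiset ℕ :=
  (Finset.univ.filter fun e => π e = κ).val.map ℓ

variable {E Q : Type*} [Fintype E] {π : E → Q}

theorem count_fiberValues (ℓ : E → ℕ) (κ : Q) (n : ℕ) :
    (fiberValues π ℓ κ).count n = Nat.card {e // (π e, ℓ e) = (κ, n)} := by
  classical
  unfold fiberValues
  rw [Multiset.count_map, Nat.card_eq_fintype_card, Fintype.card_subtype,
    ← Finset.filter_val, Finset.card_val, Finset.filter_filter]
  congr 1
  ext e
  simp [eq_comm]

/-- The multisets of values on the fibres form a complete invariant of `ℓ` under permutations
preserving `π`. -/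
theorem fiberValues_eq_iff {ℓ ℓ' : E → ℕ} :
    fiberValues π ℓ = fiberValues π ℓ' ↔
      ∃ σ : E ≃ E, (∀ e, π (σ e) = π e) ∧ ∀ e, ℓ' (σ e) = ℓ e := by
  constructor
  · intro h
    obtain ⟨σ, hσ⟩ := exists_equiv_of_card_fiber_eq (fun e => (π e, ℓ e)) (fun e => (π e, ℓ' e))
      (by
        rintro ⟨κ, n⟩
        rw [← count_fiberValues, ← count_fiberValues, h])
    exact ⟨σ, fun e => (Prod.ext_iff.1 (hσ e)).1, fun e => (Prod.ext_iff.1 (hσ e)).2⟩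
  · rintro ⟨σ, h1, h2⟩
    ext κ n
    rw [count_fiberValues, count_fiberValues]
    refine Nat.card_congr (σ.subtypeEquiv fun e => ?_)
    rw [h1, h2]

theorem sum_fiberValues [Fintype Q] (ℓ : E → ℕ) : ∑ κ, (fiberValues π ℓ κ).sum = ∑ e, ℓ e := by
  classical
  exact Finset.sum_fiberwise _ π ℓ

theorem card_fiberValues (ℓ : E → ℕ) (κ : Q) :
    Multiset.card (fiberValues π ℓ κ) = Nat.card {e // π e = κ} := by
  classical
  rw [Nat.card_eq_fintype_card, Fintype.card_subtype, fiberValues, Multiset.card_map, Finset.card_def]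

theorem mem_fiberValues {ℓ : E → ℕ} {κ : Q} {n : ℕ} :
    n ∈ fiberValues π ℓ κ ↔ ∃ e, π e = κ ∧ ℓ e = n := by
  simp [fiberValues]

theorem exists_fiberValues_eq (D : Q → Multiset ℕ)
    (h : ∀ κ, Multiset.card (D κ) = Nat.card {e // π e = κ}) : ∃ ℓ, fiberValues π ℓ = D := by
  classical
  have h1 : ∀ κ, ∃ f : {e // π e = κ} → ℕ, (Finset.univ : Finset {e // π e = κ}).val.map f = D κ :=
    fun κ => exists_map_univ_eq _ (by rw [h, Nat.card_eq_fintype_card])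
  choose f hf using h1
  refine ⟨fun e => f (π e) ⟨e, rfl⟩, ?_⟩
  ext κ n
  rw [count_fiberValues, ← hf κ, Multiset.count_map, ← Finset.filter_val, Finset.card_val,
    ← Fintype.card_subtype, ← Nat.card_eq_fintype_card]
  refine Nat.card_congr (Equiv.ofBijective
    (fun e => ⟨⟨e.1, (Prod.ext_iff.1 e.2).1⟩, ?_⟩) ⟨?_, ?_⟩)
  · obtain ⟨e, he⟩ := e
    simp only [Prod.mk.injEq] at he
    obtain ⟨rfl, rfl⟩ := he
    rfl
  · intro a b hab
    simpa [Subtype.ext_iff] using hab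
  · rintro ⟨⟨e, rfl⟩, he⟩
    exact ⟨⟨e, by simp [he]⟩, rfl⟩

/-- The multisets of `N` natural numbers, all at least `d`, with sum `u`. -/
def boundedPartitions (N d u : ℕ) : Set (Multiset ℕ) :=
  {M | Multiset.card M = N ∧ (∀ x ∈ M, d ≤ x) ∧ M.sum = u}

theorem finite_boundedPartitions (N d u : ℕ) : (boundedPartitions N d u).Finite := by
  -- Each entry is at most the sum `u` and occurs at most `N` times, so `N` copies of `0, …, u`
  -- contain the multiset.
  refine (Set.finite_Iic (N • Multiset.range (u + 1))).subset ?_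
  rintro M ⟨rfl, -, rfl⟩
  rw [Set.mem_Iic, Multiset.le_iff_count]
  intro a
  by_cases ha : a ∈ M
  · rw [Multiset.count_nsmul, Multiset.count_eq_one_of_mem (Multiset.nodup_range _)]
    · simpa using Multiset.count_le_card a M
    · rw [Multiset.mem_range, Nat.lt_succ_iff]
      exact Multiset.single_le_sum (fun _ _ => Nat.zero_le _) a ha
  · rw [Multiset.count_eq_zero_of_notMem ha]
    exact Nat.zero_le _

theorem card_boundedPartitions_one (N u : ℕ) :
    Nat.card (boundedPartitions N 1 u) = partitionCount u N := by
  unfold partitionCount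
  rw [← Fintype.card_subtype, ← Nat.card_eq_fintype_card]
  refine Nat.card_congr
    { toFun := fun M => ⟨⟨M.1, fun {i} hi => M.2.2.1 i hi, M.2.2.2⟩, M.2.1⟩
      invFun := fun q => ⟨q.1.parts, q.2, fun x hx => q.1.parts_pos hx, q.1.parts_sum⟩
      left_inv := fun M => rfl
      right_inv := fun q => rfl }

theorem card_boundedPartitions_zero (u : ℕ) : Nat.card (boundedPartitions 1 0 u) = 1 := by
  rw [Nat.card_eq_one_iff_exists]
  refine ⟨⟨{u}, by simp [boundedPartitions]⟩, ?_⟩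
  rintro ⟨M, h1, h2, h3⟩
  obtain ⟨a, rfl⟩ := Multiset.card_eq_one.1 h1
  simp at h3
  simp [h3]

theorem partitionCount_eq_zero {u N : ℕ} (h : u < N) : partitionCount u N = 0 := by
  rw [← card_boundedPartitions_one, Nat.card_eq_zero]
  left
  refine ⟨fun ⟨M, h1, h2, h3⟩ => ?_⟩
  have := Multiset.card_nsmul_le_sum h2
  rw [h1, h3] at this
  simp at this
  omega

/-- Families are sorted by the tuple of their sums; for a fixed tuple the components are
independent. -/
theorem card_families {K : ℕ} (N d : Fin K → ℕ) (n : ℕ) :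
    Nat.card {D : Fin K → Multiset ℕ // (∀ κ, Multiset.card (D κ) = N κ ∧ ∀ x ∈ D κ, d κ ≤ x) ∧
        ∑ κ, (D κ).sum = n} =
      ∑ u ∈ Finset.Nat.antidiagonalTuple K n, ∏ κ, Nat.card (boundedPartitions (N κ) (d κ) (u κ)) := by
  have hfin : ∀ N d u, Finite (boundedPartitions N d u) := finite_boundedPartitions
  rw [← Finset.sum_coe_sort]
  simp_rw [← Nat.card_pi]
  rw [← Nat.card_sigma]
  refine Nat.card_congr
    { toFun := fun D => ⟨⟨fun κ => (D.1 κ).sum, Finset.Nat.mem_antidiagonalTuple.2 D.2.2⟩,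
        fun κ => ⟨D.1 κ, (D.2.1 κ).1, (D.2.1 κ).2, rfl⟩⟩
      invFun := fun x => ⟨fun κ => (x.2 κ).1, fun κ => ⟨(x.2 κ).2.1, (x.2 κ).2.2.1⟩, by
        refine Eq.trans ?_ (Finset.Nat.mem_antidiagonalTuple.1 x.1.2)
        exact Finset.sum_congr rfl fun κ _ => (x.2 κ).2.2.2⟩
      left_inv := fun D => rfl
      right_inv := ?_ }
  rintro ⟨⟨u, hu⟩, x⟩
  obtain ⟨M, hM, rfl⟩ : ∃ (M : Fin K → Multiset ℕ)
      (hM : ∀ κ, M κ ∈ boundedPartitions (N κ) (d κ) (u κ)), x = fun κ => ⟨M κ, hM κ⟩ :=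
    ⟨fun κ => (x κ).1, fun κ => (x κ).2, rfl⟩
  obtain rfl : u = fun κ => (M κ).sum := funext fun κ => (hM κ).2.2.symm
  rfl

end Counting

/-- Sends a block to the length multisets on its classes of parallel strands (the fibres of `π`),
which separate isomorphism classes and take every admissible value. -/
theorem numBlocks_eq {E : Type*} [Fintype E] {B : Type*} [PartialOrder B] [Finite B] {k r n K : ℕ}
    [NeZero r] {G : StrandGraph (Fin r) E} (ΛB : Labeling G B) (hB : IsBasicRetract B)
    (hk : nullity B = k) (hn : r ≤ n) (π : E → Fin K)
    (hπ : ∀ e e', π e = π e' ↔ G.s e = G.s e' ∧ G.t e = G.t e') (d : Fin K → ℕ)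
    (hd : ∀ e, G.minLen e = d (π e)) :
    numBlocks n B k r = ∑ u ∈ Finset.Nat.antidiagonalTuple K (n - r),
      ∏ κ, Nat.card (boundedPartitions (Nat.card {e // π e = κ}) (d κ) (u κ)) := by
  rw [← card_families]
  have hΛ : ∀ L : blocksOn (Fin n) B k r, Nonempty (@Labeling _ E _ G (Fin n) L.1.toPartialOrder) :=
    fun L => (mem_blocksOn_iff ΛB hB hk L.1).1 L.2
  let Λ := fun L => (hΛ L).some
  refine ncard_image_mk_eq_card (latticeIso (Fin n)) _
    (fun L => ⟨fiberValues π (@Labeling.len _ _ _ _ _ L.1.toPartialOrder (Λ L)), ?_, ?_⟩) ?_ ?_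
  · intro κ
    refine ⟨card_fiberValues _ _, ?_⟩
    intro x hx
    obtain ⟨e, rfl, rfl⟩ := mem_fiberValues.1 hx
    rw [← hd]
    exact @Labeling.minLen_le_len _ _ _ _ _ L.1.toPartialOrder (Λ L) _ e
  · rw [sum_fiberValues]
    have := @Labeling.card_eq_sum _ _ _ _ _ L.1.toPartialOrder (Λ L) _ _
    simp only [Nat.card_fin] at this
    omega
  · rintro ⟨D, hD1, hD2⟩
    obtain ⟨ℓ, rfl⟩ := exists_fiberValues_eq D fun κ => (hD1 κ).1
    rw [sum_fiberValues] at hD2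
    obtain ⟨L, Λ', hΛ'⟩ := StrandGraph.exists_lattice (G := G) (Fin n) ℓ
      (fun e => by
        rw [hd]
        exact (hD1 (π e)).2 _ (mem_fiberValues.2 ⟨e, rfl, rfl⟩))
      (by simp only [Nat.card_fin]; omega)
    refine ⟨⟨L, (mem_blocksOn_iff ΛB hB hk L).2 ⟨Λ'⟩⟩, Subtype.ext ?_⟩
    refine fiberValues_eq_iff.2 ?_
    obtain ⟨σ, h1, h2⟩ := (@Labeling.nonempty_orderIso_iff _ _ _ _ _ _ L.toPartialOrder
      L.toPartialOrder _ _ _ (Λ ⟨L, (mem_blocksOn_iff ΛB hB hk L).2 ⟨Λ'⟩⟩) Λ').1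
      ⟨@OrderIso.refl _ L.toLE⟩
    refine ⟨σ, fun e => (hπ _ _).2 (h1 e), fun e => ?_⟩
    rw [← h2, hΛ']
  · intro L L'
    rw [Subtype.mk.injEq, fiberValues_eq_iff]
    refine Iff.trans ?_ (@Labeling.nonempty_orderIso_iff _ _ _ _ _ _ L.1.toPartialOrder
      L'.1.toPartialOrder _ _ _ (Λ L) (Λ L')).symm
    simp only [hπ]

/-! ### Adjunct representations as lists of strands -/

variable {E : Type v} {r k : ℕ} {G : StrandGraph (Fin (r + 1)) E} {P : Type w} [PartialOrder P]

theorem exists_castSucc_succ_of_covBy {α β : Fin (r + 1)} (h : α ⋖ β) :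
    ∃ j : Fin r, α = j.castSucc ∧ β = j.succ := by
  have h1 := Fin.covBy_iff.1 h
  rw [Nat.covBy_iff_add_one_eq] at h1
  have := β.2
  refine ⟨⟨α, by omega⟩, rfl, Fin.ext (by simp; omega)⟩

theorem castSucc_covBy_succ (j : Fin r) : j.castSucc ⋖ j.succ := by
  rw [Fin.covBy_iff, Nat.covBy_iff_add_one_eq]
  simp

namespace Labeling

/-- Parallel strands contain an element as soon as there are at least two of them. -/
theorem exists_mem_of_parallel (Λ : Labeling G P) {e e' : E} (hne : e ≠ e')
    (hs : G.s e = G.s e') (ht : G.t e = G.t e') : ∃ x, Λ.q x = Sum.inr e := by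
  by_contra h
  push Not at h
  exact hne ((Λ.thin e h).2 e' hs.symm ht.symm).symm

theorem le_iff_le_c (Λ : Labeling G P) {x y : P} {e : E} (hy : Λ.q y = Sum.inr e)
    (hne : Λ.q x ≠ Sum.inr e) : x ≤ y ↔ x ≤ Λ.c (G.s e) := by
  refine ⟨fun h => ?_, fun h => h.trans (Λ.c_lt hy).le⟩
  rcases Λ.of_le x y h with h1 | h1
  · exact absurd (h1.trans hy) hne
  · rwa [hy, G.lo_inr, ← Λ.le_c_iff] at h1

theorem ge_iff_c_le (Λ : Labeling G P) {x y : P} {e : E} (hy : Λ.q y = Sum.inr e)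
    (hne : Λ.q x ≠ Sum.inr e) : y ≤ x ↔ Λ.c (G.t e) ≤ x := by
  refine ⟨fun h => ?_, fun h => (Λ.lt_c hy).le.trans h⟩
  rcases Λ.of_le y x h with h1 | h1
  · exact absurd (h1.symm.trans hy) hne
  · rwa [hy, G.hi_inr, ← Λ.c_le_iff] at h1

/-- A presented poset has an adjunct representation: the maximal chain follows one strand between
any two successive vertices, and the other strands are adjoined to it. -/
theorem nonempty_adjunctRep (Λ : Labeling G P) [Finite E] (hcard : Nat.card E = k + r) :
    Nonempty (AdjunctRep P k) := by
  classical
  have h1 : ∀ j : Fin r, ∃ e, G.s e = j.castSucc ∧ G.t e = j.succ := fun j =>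
    G.exists_of_covBy _ _ (castSucc_covBy_succ j)
  -- The strands `π j` make up the main chain; the `k` others are adjoined.
  choose π hπs hπt using h1
  have hπ : Function.Injective π := fun i j h => by
    have := congrArg G.s h
    rw [hπs, hπs] at this
    exact Fin.castSucc_injective _ this
  have hcov : ∀ e, e ∉ Set.range π → G.s e ⋖ G.t e → ∃ j, π j ≠ e ∧ G.s (π j) = G.s e ∧
      G.t (π j) = G.t e := by
    intro e he h
    obtain ⟨j, hj, hj'⟩ := exists_castSucc_succ_of_covBy h
    exact ⟨j, fun h => he ⟨j, h⟩, (hπs j).trans hj.symm, (hπt j).trans hj'.symm⟩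
  have hne : ∀ e, e ∉ Set.range π → ∃ x, Λ.q x = Sum.inr e := by
    intro e he
    by_contra h
    push Not at h
    obtain ⟨j, hj, hs, ht⟩ := hcov e he (Λ.thin e h).1
    exact hj ((Λ.thin e h).2 _ hs ht)
  have hcard' : Nat.card (Fin k) = Nat.card {e // e ∉ Set.range π} := by
    have h2 : Nat.card {e // e ∈ Set.range π} = r := by
      rw [← Nat.card_congr (Equiv.ofInjective π hπ)]; simp
    have h3 : Nat.card {e // e ∈ Set.range π} + Nat.card {e // e ∉ Set.range π} = Nat.card E := by
      rw [← Nat.card_sum]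
      exact Nat.card_congr (Equiv.sumCompl _)
    simp only [Nat.card_fin]
    omega
  obtain ⟨ε⟩ := Finite.card_eq.1 hcard'
  let C : Fin (k + 1) → Set P := Fin.cases {x | ∀ e ∉ Set.range π, Λ.q x ≠ Sum.inr e}
    fun i => {x | Λ.q x = Sum.inr (ε i).1}
  have hC0 : ∀ x, x ∈ C 0 ↔ ∀ e ∉ Set.range π, Λ.q x ≠ Sum.inr e := fun x => Iff.rfl
  have hCs : ∀ i x, x ∈ C (Fin.succ i) ↔ Λ.q x = Sum.inr (ε i).1 := fun i x => Iff.rfl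
  have hcC : ∀ α, Λ.c α ∈ C 0 := fun α => (hC0 _).2 fun e _ => by simp
  have hπC : ∀ x j, Λ.q x = Sum.inr (π j) → x ∈ C 0 := fun x j h => (hC0 _).2 fun e he he' =>
    he ⟨j, Sum.inr.inj (h.symm.trans he')⟩
  have hC0' : ∀ x, x ∈ C 0 → (∃ α, x = Λ.c α) ∨ ∃ j, Λ.q x = Sum.inr (π j) := by
    intro x hx
    cases hq : Λ.q x with
    | inl α => exact Or.inl ⟨α, Λ.eq_c _ _ hq⟩
    | inr e =>
      right
      by_contra h
      exact (hC0 x).1 hx e (fun ⟨j, hj⟩ => h ⟨j, by rw [hj]⟩) hq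
  have hC0chain : IsChain (· ≤ ·) (C 0) := by
    intro x hx y hy _
    show x ≤ y ∨ y ≤ x
    rcases hC0' x hx with ⟨α, rfl⟩ | ⟨i, hi⟩ <;> rcases hC0' y hy with ⟨β, rfl⟩ | ⟨j, hj⟩
    · simpa using le_total α β
    · rw [Λ.c_le_iff, Λ.le_c_iff, hj]
      simp only [G.lo_inr, G.hi_inr, hπs, hπt, Fin.le_def, Fin.val_castSucc, Fin.val_succ]
      omega
    · rw [Λ.c_le_iff, Λ.le_c_iff, hi]
      simp only [G.lo_inr, G.hi_inr, hπs, hπt, Fin.le_def, Fin.val_castSucc, Fin.val_succ]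
      omega
    · rcases lt_trichotomy i j with h | rfl | h
      · left
        refine Λ.le_of _ _ ?_
        rw [hi, hj]
        simp only [G.lo_inr, G.hi_inr, hπs, hπt, Fin.le_def, Fin.val_castSucc, Fin.val_succ]
        omega
      · exact Λ.chain x y (hi.trans hj.symm)
      · right
        refine Λ.le_of _ _ ?_
        rw [hi, hj]
        simp only [G.lo_inr, G.hi_inr, hπs, hπt, Fin.le_def, Fin.val_castSucc, Fin.val_succ]
        omega
  -- Each adjoined strand bypasses an element of the main chain: an inner vertex, or an element of
  -- the chosen parallel strand. This yields both maximality of `C 0` and the noncovering condition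
  -- of the adjunct.
  have hbetween : ∀ e, e ∉ Set.range π → ∃ x ∈ C 0, Λ.c (G.s e) < x ∧ x < Λ.c (G.t e) ∧
      ∀ y, Λ.q y = Sum.inr e → ¬ x ≤ y ∧ ¬ y ≤ x := by
    intro e he
    by_cases hst : G.s e ⋖ G.t e
    · obtain ⟨j, hj, hs, ht⟩ := hcov e he hst
      obtain ⟨x, hx⟩ := Λ.exists_mem_of_parallel hj hs ht
      refine ⟨x, hπC x j hx, hs ▸ Λ.c_lt hx, ht ▸ Λ.lt_c hx, fun y hy => ?_⟩
      have hne : Λ.q x ≠ Sum.inr e := fun h => hj (Sum.inr.inj (hx.symm.trans h))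
      rw [Λ.le_iff_le_c hy hne, Λ.ge_iff_c_le hy hne]
      exact ⟨(hs ▸ Λ.c_lt hx).not_ge, (ht ▸ Λ.lt_c hx).not_ge⟩
    · obtain ⟨α, h1, h2⟩ := (not_covBy_iff (G.lt e)).1 hst
      refine ⟨Λ.c α, hcC α, by simpa, by simpa, fun y hy => ?_⟩
      rw [Λ.c_le_iff, Λ.le_c_iff, hy]
      exact ⟨h1.not_ge, h2.not_ge⟩
  refine ⟨{
    C := C
    a := fun i => Λ.c (G.s (ε i).1)
    b := fun i => Λ.c (G.t (ε i).1)
    nonempty := ?_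
    chain := ?_
    isMaxChain_zero := ?_
    a_mem := fun i => hcC _
    b_mem := fun i => hcC _
    adjunct := ?_
    union := ?_ }⟩
  · intro i
    cases i using Fin.cases with
    | zero => exact ⟨_, hcC 0⟩
    | succ i => exact hne _ (ε i).2
  · intro i
    cases i using Fin.cases with
    | zero => exact hC0chain
    | succ i =>
      intro x hx y hy _
      exact Λ.chain x y (((hCs i x).1 hx).trans ((hCs i y).1 hy).symm)
  · refine ⟨hC0chain, fun t ht hsub => hsub.antisymm fun y hy => (hC0 y).2 fun e he hye => ?_⟩
    obtain ⟨x, hx, -, -, h⟩ := hbetween e he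
    obtain ⟨h1, h2⟩ := h y hye
    rcases ht.total (hsub hx) hy with h3 | h3
    · exact h1 h3
    · exact h2 h3
  · intro i
    have hsub : C 0 ⊆ ⋃ j ≤ i.castSucc, C j := fun x hx =>
      Set.mem_iUnion₂.2 ⟨0, Fin.zero_le _, hx⟩
    have hq : ∀ x ∈ ⋃ j ≤ i.castSucc, C j, Λ.q x ≠ Sum.inr (ε i).1 := by
      intro x hx
      obtain ⟨j, hj, hxj⟩ := Set.mem_iUnion₂.1 hx
      cases j using Fin.cases with
      | zero => exact (hC0 x).1 hxj _ (ε i).2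
      | succ j =>
        rw [(hCs j x).1 hxj]
        intro h
        have : j = i := ε.injective (Subtype.ext (Sum.inr.inj h))
        subst this
        simp [Fin.le_def] at hj
    obtain ⟨x, hx, h1, h2, -⟩ := hbetween _ (ε i).2
    exact
      { disjoint := Set.disjoint_left.2 fun x hx hx' => hq x hx hx'
        left_mem := hsub (hcC _)
        right_mem := hsub (hcC _)
        lt := by simpa using G.lt _
        not_covBy := ⟨x, hsub hx, h1, h2⟩
        le_iff := fun x hx y hy => Λ.le_iff_le_c hy (hq x hx)
        ge_iff := fun x hx y hy => Λ.ge_iff_c_le hy (hq x hx) }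
  · refine Set.eq_univ_of_forall fun x => Set.mem_iUnion.2 ?_
    by_cases hx : x ∈ C 0
    · exact ⟨0, hx⟩
    · rw [hC0] at hx
      push Not at hx
      obtain ⟨e, he, hxe⟩ := hx
      refine ⟨Fin.succ (ε.symm ⟨e, he⟩), (hCs _ x).2 ?_⟩
      simpa using hxe

end Labeling

namespace AdjunctRep

variable (R : AdjunctRep P k)

theorem zero_subset (i : Fin k) : R.C 0 ⊆ ⋃ j ≤ i.castSucc, R.C j := fun _ hx =>
  Set.mem_iUnion₂.2 ⟨0, Fin.zero_le _, hx⟩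

theorem notMem_succ_of_le {i : Fin k} {j : Fin (k + 1)} (hj : j ≤ i.castSucc) {x : P}
    (hx : x ∈ R.C j) : x ∉ R.C i.succ :=
  Set.disjoint_left.1 (R.adjunct i).disjoint (Set.mem_iUnion₂.2 ⟨j, hj, hx⟩)

theorem notMem_succ_of_mem_zero (i : Fin k) {x : P} (hx : x ∈ R.C 0) : x ∉ R.C i.succ :=
  R.notMem_succ_of_le (Fin.zero_le _) hx

theorem exists_mem (x : P) : ∃ j, x ∈ R.C j := Set.mem_iUnion.1 (R.union ▸ Set.mem_univ x)

/-- The elements of an adjoined chain compare with the other elements in the same way. -/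
theorem le_iff_and_ge_iff {i : Fin k} {x y : P} (hy : y ∈ R.C i.succ) (hx : x ∉ R.C i.succ) :
    (x ≤ y ↔ x ≤ R.a i) ∧ (y ≤ x ↔ R.b i ≤ x) := by
  obtain ⟨j, hj⟩ := R.exists_mem x
  rcases le_or_gt j i.castSucc with h | h
  · have hx' : x ∈ ⋃ j ≤ i.castSucc, R.C j := Set.mem_iUnion₂.2 ⟨j, h, hj⟩
    exact ⟨(R.adjunct i).le_iff x hx' y hy, (R.adjunct i).ge_iff x hx' y hy⟩
  · have hne : j ≠ i.succ := by rintro rfl; exact hx hj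
    cases j using Fin.cases with
    | zero => exact absurd h (Fin.zero_le _).not_gt
    | succ j =>
      have hij : i.succ ≤ j.castSucc := by
        simp only [ne_eq, Fin.succ_inj] at hne
        rw [Fin.ext_iff] at hne
        simp only [Fin.lt_def, Fin.le_def, Fin.val_succ, Fin.val_castSucc] at h ⊢
        omega
      have hy' : y ∈ ⋃ l ≤ j.castSucc, R.C l := Set.mem_iUnion₂.2 ⟨_, hij, hy⟩
      have A := R.adjunct i
      have A' := R.adjunct j
      -- For `x` in a later chain, both sides reduce to a comparison between ends of the two adjunct
      -- pairs, all of which lie in `C 0`.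
      constructor
      · rw [A'.ge_iff y hy' x hj, A'.ge_iff _ (R.zero_subset j (R.a_mem i)) x hj,
          A.le_iff _ (R.zero_subset i (R.b_mem j)) y hy]
      · rw [A'.le_iff y hy' x hj, A'.le_iff _ (R.zero_subset j (R.b_mem i)) x hj,
          A.ge_iff _ (R.zero_subset i (R.a_mem j)) y hy]

theorem a_lt {i : Fin k} {y : P} (hy : y ∈ R.C i.succ) : R.a i < y :=
  have h := R.notMem_succ_of_mem_zero i (R.a_mem i)
  ((R.le_iff_and_ge_iff hy h).1.2 le_rfl).lt_of_ne fun h' => h (h' ▸ hy)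

theorem lt_b {i : Fin k} {y : P} (hy : y ∈ R.C i.succ) : y < R.b i :=
  have h := R.notMem_succ_of_mem_zero i (R.b_mem i)
  ((R.le_iff_and_ge_iff hy h).2.2 le_rfl).lt_of_ne fun h' => h (h' ▸ hy)

theorem mem_irr {i : Fin k} {y : P} (hy : y ∈ R.C i.succ) : y ∈ Irr P := by
  constructor
  · have key : ∀ w, w ⋖ y → w ∈ R.C i.succ ∨ w = R.a i := by
      intro w hw
      by_cases h : w ∈ R.C i.succ
      · exact Or.inl h
      · have h1 := (R.le_iff_and_ge_iff hy h).1.1 hw.le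
        exact Or.inr ((hw.eq_or_eq h1 (R.a_lt hy).le).resolve_right (R.a_lt hy).ne).symm
    have aux : ∀ w w', w ⋖ y → w' ⋖ y → w ≤ w' → w = w' := fun w w' h1 h2 h3 =>
      ((h1.eq_or_eq h3 h2.le).resolve_right h2.lt.ne).symm
    intro w hw w' hw'
    rcases key w hw with h1 | h1 <;> rcases key w' hw' with h2 | h2
    · rcases (R.chain _).total h1 h2 with h | h
      · exact aux _ _ hw hw' h
      · exact (aux _ _ hw' hw h).symm
    · exact (aux _ _ hw' hw (h2 ▸ (R.a_lt h1).le)).symm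
    · exact aux _ _ hw hw' (h1 ▸ (R.a_lt h2).le)
    · rw [h1, h2]
  · have key : ∀ w, y ⋖ w → w ∈ R.C i.succ ∨ w = R.b i := by
      intro w hw
      by_cases h : w ∈ R.C i.succ
      · exact Or.inl h
      · have h1 := (R.le_iff_and_ge_iff hy h).2.1 hw.le
        exact Or.inr ((hw.eq_or_eq (R.lt_b hy).le h1).resolve_left (R.lt_b hy).ne').symm
    have aux : ∀ w w', y ⋖ w → y ⋖ w' → w ≤ w' → w = w' := fun w w' h1 h2 h3 =>
      (h2.eq_or_eq h1.le h3).resolve_left h1.lt.ne'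
    intro w hw w' hw'
    rcases key w hw with h1 | h1 <;> rcases key w' hw' with h2 | h2
    · rcases (R.chain _).total h1 h2 with h | h
      · exact aux _ _ hw hw' h
      · exact (aux _ _ hw' hw h).symm
    · exact aux _ _ hw hw' (h2 ▸ (R.lt_b h1).le)
    · exact (aux _ _ hw' hw (h1 ▸ (R.lt_b h2).le)).symm
    · rw [h1, h2]

/-- The least element of the adjoined chain and an element of the old part both cover `a i`. If they
coincided, that chain would lie below some old `z < b i`, which the adjunct order forbids. -/
theorem a_mem_red [Finite P] (i : Fin k) : R.a i ∈ Red P := by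
  rintro ⟨-, h⟩
  obtain ⟨y, hy, hmin⟩ := WellFounded.has_min (wellFounded_lt (α := P)) _ (R.nonempty i.succ)
  have hcov : R.a i ⋖ y := by
    refine ⟨R.a_lt hy, fun w h1 h2 => ?_⟩
    by_cases hw : w ∈ R.C i.succ
    · exact hmin w hw h2
    · exact h1.not_ge ((R.le_iff_and_ge_iff hy hw).1.1 h2.le)
  obtain ⟨z, hz, haz, hzb⟩ := (R.adjunct i).not_covBy
  obtain ⟨u, hu, huz⟩ := haz.exists_covby_le
  obtain rfl := h hcov hu
  have hz' := Set.disjoint_left.1 (R.adjunct i).disjoint hz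
  exact hzb.not_ge ((R.le_iff_and_ge_iff hy hz').2.1 huz)

theorem b_mem_red [Finite P] (i : Fin k) : R.b i ∈ Red P := by
  rintro ⟨h, -⟩
  obtain ⟨y, hy, hmax⟩ := WellFounded.has_min (wellFounded_gt (α := P)) _ (R.nonempty i.succ)
  have hcov : y ⋖ R.b i := by
    refine ⟨R.lt_b hy, fun w h1 h2 => ?_⟩
    by_cases hw : w ∈ R.C i.succ
    · exact hmax w hw h1
    · exact h2.not_ge ((R.le_iff_and_ge_iff hy hw).2.1 h1.le)
  obtain ⟨z, hz, haz, hzb⟩ := (R.adjunct i).not_covBy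
  obtain ⟨u, hzu, hu⟩ := hzb.exists_le_covby
  obtain rfl := h hcov hu
  have hz' := Set.disjoint_left.1 (R.adjunct i).disjoint hz
  exact haz.not_ge ((R.le_iff_and_ge_iff hy hz').1.1 hzu)

/-- In an adjunct representation of a presented poset, the adjoined chains are strands between
the elements of the adjunct pairs; the remaining strands join successive vertices, one for each
pair of these. -/
theorem exists_equiv_strands [Finite P] (Λ : Labeling G P) (hcard : Nat.card E = k + r) :
    ∃ Φ : Fin k ⊕ Fin r ≃ E,
      (∀ i, R.a i = Λ.c (G.s (Φ (Sum.inl i))) ∧ R.b i = Λ.c (G.t (Φ (Sum.inl i)))) ∧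
      ∀ j, G.s (Φ (Sum.inr j)) = j.castSucc ∧ G.t (Φ (Sum.inr j)) = j.succ := by
  have hE := Λ.finite_strands
  have hred : ∀ x, x ∈ Red P → ∃ α, x = Λ.c α := fun x hx => by
    rw [Λ.red_eq_range] at hx
    obtain ⟨α, rfl⟩ := hx
    exact ⟨α, rfl⟩
  have hcC : ∀ α i, Λ.c α ∉ R.C (Fin.succ i) := fun α i h => Λ.c_mem_red α (R.mem_irr h)
  have hends : ∀ i y, y ∈ R.C (Fin.succ i) → ∃ e, Λ.q y = Sum.inr e ∧ R.a i = Λ.c (G.s e) ∧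
      R.b i = Λ.c (G.t e) := by
    intro i y hy
    obtain ⟨e, he⟩ := Λ.mem_irr_iff.1 (R.mem_irr hy)
    refine ⟨e, he, ?_, ?_⟩
    · apply le_antisymm
      · obtain ⟨α, hα⟩ := hred _ (R.a_mem_red i)
        have := (R.a_lt hy).le
        rw [hα, Λ.c_le_iff, he] at this
        rw [hα]
        simpa using this
      · exact (R.le_iff_and_ge_iff hy (hcC _ i)).1.1 (Λ.c_lt he).le
    · apply le_antisymm
      · exact (R.le_iff_and_ge_iff hy (hcC _ i)).2.1 (Λ.lt_c he).le
      · obtain ⟨α, hα⟩ := hred _ (R.b_mem_red i)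
        have := (R.lt_b hy).le
        rw [hα, Λ.le_c_iff, he] at this
        rw [hα]
        simpa using this
  choose y hy using fun i : Fin k => R.nonempty i.succ
  choose ε hε ha hb using fun i => hends i (y i) (hy i)
  -- A strand element outside the adjoined chain but comparable with `y i` would have to lie below
  -- `a i` or above `b i`, which are the ends of the strand.
  have hfib : ∀ i x, Λ.q x = Sum.inr (ε i) → x ∈ R.C (Fin.succ i) := by
    intro i x hx
    by_contra hxC
    rcases Λ.chain x (y i) (hx.trans (hε i).symm) with h | h
    · have := (R.le_iff_and_ge_iff (hy i) hxC).1.1 h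
      rw [ha] at this
      exact (Λ.c_lt hx).not_ge this
    · have := (R.le_iff_and_ge_iff (hy i) hxC).2.1 h
      rw [hb] at this
      exact (Λ.lt_c hx).not_ge this
  have hεinj : Function.Injective ε := by
    intro i j hij
    have h1 : y j ∈ R.C i.succ := hfib i (y j) (by rw [hε, hij])
    have h2 : y i ∈ R.C j.succ := hfib j (y i) (by rw [hε, hij])
    rcases lt_trichotomy i j with h | h | h
    · exact absurd h2 (R.notMem_succ_of_le (Fin.succ_le_castSucc_iff.2 h) (hy i))
    · exact h
    · exact absurd h1 (R.notMem_succ_of_le (Fin.succ_le_castSucc_iff.2 h) (hy j))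
  have hc0 : ∀ α, Λ.c α ∈ R.C 0 := by
    intro α
    obtain ⟨j, hj⟩ := R.exists_mem (Λ.c α)
    cases j using Fin.cases with
    | zero => exact hj
    | succ j => exact absurd hj (hcC _ _)
  -- If all strands between successive vertices were adjoined, `C 0` would contain nothing strictly
  -- between these vertices, and adding `y i` would give a longer chain.
  have hprim : ∀ j : Fin r, ∃ e, e ∉ Set.range ε ∧ G.s e = j.castSucc ∧ G.t e = j.succ := by
    intro j
    by_contra hcon
    push Not at hcon
    obtain ⟨e, hs, ht⟩ := G.exists_of_covBy _ _ (castSucc_covBy_succ j)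
    obtain ⟨i, rfl⟩ : e ∈ Set.range ε := by
      by_contra h
      exact hcon e h hs ht
    have hyC : y i ∉ R.C 0 := fun h => R.notMem_succ_of_mem_zero i h (hy i)
    have hins : IsChain (· ≤ ·) (insert (y i) (R.C 0)) := by
      refine (R.chain 0).insert fun z hz _ => ?_
      have h1 : z ≤ R.a i → y i ≤ z ∨ z ≤ y i := fun h => Or.inr (h.trans (R.a_lt (hy i)).le)
      have h2 : R.b i ≤ z → y i ≤ z ∨ z ≤ y i := fun h => Or.inl ((R.lt_b (hy i)).le.trans h)
      rcases (R.chain 0).total hz (R.a_mem i) with h | h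
      · exact h1 h
      rcases (R.chain 0).total hz (R.b_mem i) with h' | h'
      · rw [ha, Λ.c_le_iff, hs] at h
        rw [hb, Λ.le_c_iff, ht] at h'
        cases hq : Λ.q z with
        | inl α =>
          rw [hq] at h h'
          obtain rfl := Λ.eq_c _ _ hq
          rcases (castSucc_covBy_succ j).eq_or_eq h h' with h3 | h3
          · refine h1 ?_
            rw [ha, hs, ← h3]; simp
          · refine h2 ?_
            rw [hb, ht, ← h3]; simp
        | inr e =>
          rw [hq] at h h'
          simp only [G.lo_inr, G.hi_inr] at h h'
          have hc := castSucc_covBy_succ j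
          have hs' : G.s e = j.castSucc :=
            (hc.eq_or_eq h ((G.lt e).le.trans h')).resolve_right ((G.lt e).trans_le h').ne
          have ht' : G.t e = j.succ :=
            (hc.eq_or_eq (h.trans (G.lt e).le) h').resolve_left (h.trans_lt (G.lt e)).ne'
          obtain ⟨i', rfl⟩ : e ∈ Set.range ε := by
            by_contra h
            exact hcon e h hs' ht'
          exact absurd (hfib i' z hq) (R.notMem_succ_of_mem_zero i' hz)
      · exact h2 h'
    have := R.isMaxChain_zero.2 hins (Set.subset_insert _ _)
    exact hyC (this ▸ Set.mem_insert _ _)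
  choose π hπ hπs hπt using hprim
  have hinj : Function.Injective (Sum.elim ε π) := by
    rintro (i | i) (j | j) h
    · exact congrArg _ (hεinj h)
    · exact absurd ⟨i, h⟩ (hπ j)
    · exact absurd ⟨j, h.symm⟩ (hπ i)
    · have h1 : G.s (π i) = G.s (π j) := congrArg G.s h
      rw [hπs, hπs] at h1
      exact congrArg _ (Fin.castSucc_injective _ h1)
  have hbij : Function.Bijective (Sum.elim ε π) :=
    (Nat.bijective_iff_injective_and_card _).2 ⟨hinj, by simp [hcard]⟩
  exact ⟨Equiv.ofBijective _ hbij, fun i => ⟨ha i, hb i⟩, fun j => ⟨hπs j, hπt j⟩⟩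

end AdjunctRep

theorem card_fiber_of_equiv_sum {X Y E Q : Type*} [Finite X] [Finite Y] (Φ : X ⊕ Y ≃ E)
    (f : E → Q) (q : Q) :
    Nat.card {e // f e = q} =
      Nat.card {x // f (Φ (Sum.inl x)) = q} + Nat.card {y // f (Φ (Sum.inr y)) = q} := by
  rw [← Nat.card_sum]
  refine Nat.card_congr ?_
  exact (Φ.symm.subtypeEquiv (q := fun z => f (Φ z) = q) fun e => by simp).trans
    (Equiv.subtypeSum)

theorem card_eq_sum_card_fiber {X Q : Type*} [Finite X] [Fintype Q] (f : X → Q) :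
    Nat.card X = ∑ q, Nat.card {x // f x = q} := by
  rw [← Nat.card_sigma]
  exact Nat.card_congr (Equiv.sigmaFiberEquiv f).symm

/-! ### Adjunct pairs and classes of parallel strands -/

section Pairs

variable {E : Type v} {r k : ℕ} {G : StrandGraph (Fin (r + 1)) E} {P : Type w} [PartialOrder P]

namespace Labeling

variable (Λ : Labeling G P)

/-- The ends of a strand. -/
def ends (e : E) : P × P := (Λ.c (G.s e), Λ.c (G.t e))

theorem ends_eq_ends_iff {e e' : E} :
    Λ.ends e = Λ.ends e' ↔ G.s e = G.s e' ∧ G.t e = G.t e' := by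
  unfold ends
  rw [Prod.mk.injEq, Λ.c_injective.eq_iff, Λ.c_injective.eq_iff]

theorem ioo_ends_subset_irr_iff [Finite P] {e : E} :
    Set.Ioo (Λ.ends e).1 (Λ.ends e).2 ⊆ Irr P ↔ G.s e ⋖ G.t e := by
  constructor
  · intro h
    refine ⟨G.lt e, fun α h1 h2 => ?_⟩
    exact Λ.c_mem_red α (h ⟨by simpa [ends], by simpa [ends]⟩)
  · rintro h x ⟨h1, h2⟩
    by_contra hx
    have hx' : x ∈ Red P := hx
    rw [Λ.red_eq_range] at hx'
    obtain ⟨α, rfl⟩ := hx'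
    exact h.2 (by simpa [ends] using h1) (by simpa [ends] using h2)

theorem ioo_ends_inter_red_nonempty_iff [Finite P] {e : E} :
    (Set.Ioo (Λ.ends e).1 (Λ.ends e).2 ∩ Red P).Nonempty ↔ ¬ G.s e ⋖ G.t e := by
  rw [← Λ.ioo_ends_subset_irr_iff, Set.not_subset]
  rfl

end Labeling

variable {Λ : Labeling G P} {R : AdjunctRep P k} {Φ : Fin k ⊕ Fin r ≃ E}

/-- A strand of the main chain has the ends of an adjunct pair exactly when some adjoined strand is
parallel to it, that is, when it is not thin. -/
theorem mem_pairs_iff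
    (hΦ : ∀ i, (R.a i, R.b i) = Λ.ends (Φ (Sum.inl i)))
    (hΦ' : ∀ j, G.s (Φ (Sum.inr j)) = j.castSucc ∧ G.t (Φ (Sum.inr j)) = j.succ) {e : E} :
    Λ.ends e ∈ R.pairs ↔ ¬ G.Thin e := by
  constructor
  · rintro ⟨i, hi⟩ hth
    replace hi : (R.a i, R.b i) = Λ.ends e := hi
    rw [hΦ, Λ.ends_eq_ends_iff] at hi
    obtain ⟨j, hj, hj'⟩ := exists_castSucc_succ_of_covBy hth.1
    have h1 := hth.2 _ hi.1 hi.2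
    have h2 := hth.2 _ ((hΦ' j).1.trans hj.symm) ((hΦ' j).2.trans hj'.symm)
    have := Φ.injective (h1.trans h2.symm)
    cases this
  · intro hth
    obtain ⟨z, rfl⟩ := Φ.surjective e
    rcases z with i | j
    · exact ⟨i, hΦ i⟩
    · have hcov : G.s (Φ (Sum.inr j)) ⋖ G.t (Φ (Sum.inr j)) := by
        rw [(hΦ' j).1, (hΦ' j).2]
        exact castSucc_covBy_succ j
      unfold StrandGraph.Thin at hth
      push Not at hth
      obtain ⟨e', hs, ht, hne⟩ := hth hcov
      obtain ⟨z, rfl⟩ := Φ.surjective e'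
      rcases z with i | j'
      · exact ⟨i, (hΦ i).trans (Λ.ends_eq_ends_iff.2 ⟨hs, ht⟩)⟩
      · rw [(hΦ' _).1, (hΦ' _).1] at hs
        exact absurd (by rw [Fin.castSucc_injective _ hs]) hne

theorem card_strands_with_ends
    (hΦ : ∀ i, (R.a i, R.b i) = Λ.ends (Φ (Sum.inl i)))
    (hΦ' : ∀ j, G.s (Φ (Sum.inr j)) = j.castSucc ∧ G.t (Φ (Sum.inr j)) = j.succ) (e : E)
    [Decidable (G.s e ⋖ G.t e)] :
    Nat.card {e' // Λ.ends e' = Λ.ends e} =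
      R.mult (Λ.ends e) + if G.s e ⋖ G.t e then 1 else 0 := by
  rw [card_fiber_of_equiv_sum Φ]
  congr 1
  · simp_rw [← hΦ]
    rfl
  · split_ifs with h
    · obtain ⟨j, hj, hj'⟩ := exists_castSucc_succ_of_covBy h
      rw [Nat.card_eq_one_iff_exists]
      refine ⟨⟨j, Λ.ends_eq_ends_iff.2 ⟨(hΦ' j).1.trans hj.symm, (hΦ' j).2.trans hj'.symm⟩⟩, ?_⟩
      rintro ⟨j', h'⟩
      have := (Λ.ends_eq_ends_iff.1 h').1
      rw [(hΦ' j').1, hj] at this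
      exact Subtype.ext (Fin.castSucc_injective _ this)
    · rw [Nat.card_eq_zero]
      left
      refine ⟨fun ⟨j, hj⟩ => h ?_⟩
      have := Λ.ends_eq_ends_iff.1 hj
      rw [← this.1, ← this.2, (hΦ' j).1, (hΦ' j).2]
      exact castSucc_covBy_succ j

end Pairs

theorem sum_minLen {I E : Type*} [LinearOrder I] [Fintype E] (G : StrandGraph I E) :
    ∑ e, G.minLen e + Nat.card {e // G.Thin e} = Nat.card E := by
  classical
  have h : ∑ e, G.minLen e = (Finset.univ.filter fun e => ¬ G.Thin e).card := by
    rw [Finset.card_filter]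
    refine Finset.sum_congr rfl fun e _ => ?_
    unfold StrandGraph.minLen
    split_ifs <;> rfl
  rw [h, Nat.card_eq_fintype_card, Nat.card_eq_fintype_card, Fintype.card_subtype, add_comm,
    Finset.card_filter_add_card_filter_not]
  rfl

theorem count_of_adjunctRep {E : Type v} [Fintype E] {B : Type w} [PartialOrder B] [Finite B]
    {r k : ℕ} {G : StrandGraph (Fin (r + 1)) E} (Λ : Labeling G B) (hB : IsBasicRetract B)
    (hk : nullity B = k) (hcard : Nat.card E = k + r) (R : AdjunctRep B k) {m p : ℕ}
    (e : Fin m ≃ R.innerPairs) (f : Fin p ≃ R.outerPairs) :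
    k = (∑ j, R.mult (e j)) + (∑ j, R.mult (f j)) ∧ Nat.card B = (r + 1) + m + k ∧
    ∃ l, r + 1 = m + 1 + l ∧ ∀ n, r + 1 ≤ n →
      numBlocks n B k (r + 1) =
        ∑ u ∈ (Finset.Nat.antidiagonalTuple (m + p + l) (n - (r + 1))).filter
            (fun u : Fin (m + p + l) → ℕ =>
              (∀ i : Fin m, R.mult (e i) + 1 ≤ u (Fin.castAdd l (Fin.castAdd p i))) ∧
              (∀ i : Fin p, R.mult (f i) ≤ u (Fin.castAdd l (Fin.natAdd m i)))),
          (∏ i : Fin m, partitionCount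
              (u (Fin.castAdd l (Fin.castAdd p i))) (R.mult (e i) + 1)) *
          (∏ i : Fin p, partitionCount
              (u (Fin.castAdd l (Fin.natAdd m i))) (R.mult (f i))) := by
  classical
  obtain ⟨Φ, hΦ0, hΦ'⟩ := R.exists_equiv_strands Λ hcard
  have hΦ : ∀ i, (R.a i, R.b i) = Λ.ends (Φ (Sum.inl i)) := fun i =>
    Prod.ext (hΦ0 i).1 (hΦ0 i).2
  have hmem := fun {e'} => mem_pairs_iff (e := e') hΦ hΦ'
  have hpairs : ∀ q ∈ R.pairs, ∃ e', Λ.ends e' = q := by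
    rintro _ ⟨i, rfl⟩
    exact ⟨_, (hΦ i).symm⟩
  -- The classes of parallel strands are indexed by the inner pairs, the outer pairs and the thin
  -- strands, in this order.
  let l := Nat.card {e // G.Thin e}
  let h : Fin l ≃ {e // G.Thin e} := (Finite.equivFin _).symm
  let pr : Fin (m + p + l) → B × B :=
    Fin.addCases (Fin.addCases (fun i => (e i).1) fun i => (f i).1) fun i => Λ.ends (h i).1
  have pr_e : ∀ i, pr (Fin.castAdd l (Fin.castAdd p i)) = (e i).1 := fun i => by simp [pr]
  have pr_f : ∀ i, pr (Fin.castAdd l (Fin.natAdd m i)) = (f i).1 := fun i => by simp [pr]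
  have pr_h : ∀ i, pr (Fin.natAdd (m + p) i) = Λ.ends (h i).1 := fun i => by simp [pr]
  have hcases : ∀ κ : Fin (m + p + l), (∃ i, κ = Fin.castAdd l (Fin.castAdd p i)) ∨
      (∃ i, κ = Fin.castAdd l (Fin.natAdd m i)) ∨ ∃ i, κ = Fin.natAdd (m + p) i := by
    intro κ
    cases κ using Fin.addCases with
    | left κ =>
      cases κ using Fin.addCases with
      | left i => exact Or.inl ⟨i, rfl⟩
      | right i => exact Or.inr (Or.inl ⟨i, rfl⟩)
    | right i => exact Or.inr (Or.inr ⟨i, rfl⟩)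
  have inner_ne_outer : ∀ i j, (e i).1 ≠ (f j).1 := by
    intro i j hij
    obtain ⟨x, hx⟩ := (f j).2.2
    exact hx.2 ((hij ▸ (e i).2.2) hx.1)
  have thin_notMem : ∀ i, Λ.ends (h i).1 ∉ R.pairs := fun i => by
    rw [hmem]; exact not_not.2 (h i).2
  have pr_inj : Function.Injective pr := by
    intro κ κ' hκ
    rcases hcases κ with ⟨i, rfl⟩ | ⟨i, rfl⟩ | ⟨i, rfl⟩ <;>
      rcases hcases κ' with ⟨j, rfl⟩ | ⟨j, rfl⟩ | ⟨j, rfl⟩ <;>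
      simp only [pr_e, pr_f, pr_h] at hκ
    · rw [e.injective (Subtype.ext hκ)]
    · exact absurd hκ (inner_ne_outer i j)
    · exact absurd (hκ ▸ (e i).2.1) (thin_notMem j)
    · exact absurd hκ.symm (inner_ne_outer j i)
    · rw [f.injective (Subtype.ext hκ)]
    · exact absurd (hκ ▸ (f i).2.1) (thin_notMem j)
    · exact absurd (hκ ▸ (e j).2.1) (thin_notMem i)
    · exact absurd (hκ ▸ (f j).2.1) (thin_notMem i)
    · have h1 := Λ.ends_eq_ends_iff.1 hκ
      have h2 := (h j).2.2 _ h1.1 h1.2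
      rw [h.injective (Subtype.ext h2)]
  have hex : ∀ e', ∃ κ, pr κ = Λ.ends e' := by
    intro e'
    by_cases hth : G.Thin e'
    · exact ⟨Fin.natAdd (m + p) (h.symm ⟨e', hth⟩), by rw [pr_h]; simp⟩
    · have hp := hmem.2 hth
      by_cases hc : G.s e' ⋖ G.t e'
      · refine ⟨Fin.castAdd l (Fin.castAdd p (e.symm ⟨Λ.ends e', hp, ?_⟩)), by rw [pr_e]; simp⟩
        exact Λ.ioo_ends_subset_irr_iff.2 hc
      · refine ⟨Fin.castAdd l (Fin.natAdd m (f.symm ⟨Λ.ends e', hp, ?_⟩)), by rw [pr_f]; simp⟩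
        exact Λ.ioo_ends_inter_red_nonempty_iff.2 hc
  choose π hπ using hex
  have hπκ : ∀ e' κ, π e' = κ ↔ Λ.ends e' = pr κ := fun e' κ => by
    rw [← pr_inj.eq_iff, hπ]
  have hNe : ∀ i, Nat.card {e' // π e' = Fin.castAdd l (Fin.castAdd p i)} =
      R.mult (e i) + 1 := by
    intro i
    obtain ⟨e', he'⟩ := hpairs _ (e i).2.1
    have hcov : G.s e' ⋖ G.t e' := Λ.ioo_ends_subset_irr_iff.1 (he' ▸ (e i).2.2)
    simp_rw [hπκ, pr_e]
    rw [← he', card_strands_with_ends hΦ hΦ', if_pos hcov]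
  have hNf : ∀ i, Nat.card {e' // π e' = Fin.castAdd l (Fin.natAdd m i)} = R.mult (f i) := by
    intro i
    obtain ⟨e', he'⟩ := hpairs _ (f i).2.1
    have hcov : ¬ G.s e' ⋖ G.t e' := Λ.ioo_ends_inter_red_nonempty_iff.1 (he' ▸ (f i).2.2)
    simp_rw [hπκ, pr_f]
    rw [← he', card_strands_with_ends hΦ hΦ', if_neg hcov, add_zero]
  have hNh : ∀ i, Nat.card {e' // π e' = Fin.natAdd (m + p) i} = 1 := by
    intro i
    rw [Nat.card_eq_one_iff_exists]
    refine ⟨⟨(h i).1, by rw [hπκ, pr_h]⟩, ?_⟩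
    rintro ⟨e', he'⟩
    rw [hπκ, pr_h, Λ.ends_eq_ends_iff] at he'
    exact Subtype.ext ((h i).2.2 _ he'.1 he'.2)
  have hksum : k = (∑ j, R.mult (e j)) + (∑ j, R.mult (f j)) := by
    have h1 := card_eq_sum_card_fiber fun i : Fin k => π (Φ (Sum.inl i))
    have h2 : ∀ κ, Nat.card {i // π (Φ (Sum.inl i)) = κ} = R.mult (pr κ) := by
      intro κ
      simp_rw [hπκ, ← hΦ]
      rfl
    have h3 : ∀ i, R.mult (Λ.ends (h i).1) = 0 := by
      intro i
      unfold AdjunctRep.mult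
      rw [Set.ncard_eq_zero, Set.eq_empty_iff_forall_notMem]
      intro x hx
      exact thin_notMem i ⟨x, hx⟩
    simp_rw [h2] at h1
    rw [Fin.sum_univ_add, Fin.sum_univ_add] at h1
    simpa [pr_e, pr_f, pr_h, h3] using h1
  -- Counting strands class by class gives `r = m + l`; here the number of vertices is `r + 1`.
  have hEsum : k + r = k + m + l := by
    have h1 := card_eq_sum_card_fiber π
    rw [Fin.sum_univ_add, Fin.sum_univ_add] at h1
    simp_rw [hNe, hNf, hNh] at h1
    rw [hcard, Finset.sum_add_distrib] at h1
    simp only [Finset.sum_const, Finset.card_univ, Fintype.card_fin, smul_eq_mul, mul_one] at h1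
    omega
  refine ⟨hksum, ?_, l, by omega, fun n hn => ?_⟩
  · rw [Λ.card_eq_sum]
    simp_rw [Λ.len_eq_minLen hB]
    have := sum_minLen G
    rw [hcard] at this
    change _ + l = _ at this
    simp only [Nat.card_fin]
    omega
  -- Minimal lengths are 1 on the classes of pairs and 0 on thin strands.
  let d : Fin (m + p + l) → ℕ := Fin.addCases (fun _ => 1) fun _ => 0
  have hd : ∀ e', G.minLen e' = d (π e') := by
    intro e'
    unfold StrandGraph.minLen
    cases hκ : π e' using Fin.addCases with
    | left κ =>
      rw [if_neg]
      · simp [d]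
      · rw [← hmem, (hπκ _ _).1 hκ]
        cases κ using Fin.addCases with
        | left i => rw [pr_e]; exact (e i).2.1
        | right i => rw [pr_f]; exact (f i).2.1
    | right i =>
      rw [hπκ, pr_h, Λ.ends_eq_ends_iff] at hκ
      have := (h i).2.2 _ hκ.1 hκ.2
      rw [if_pos (this ▸ (h i).2)]
      simp [d]
  rw [numBlocks_eq Λ hB hk hn π
    (fun a b => by rw [hπκ, hπ, Λ.ends_eq_ends_iff]) d hd, Finset.sum_filter]
  refine Finset.sum_congr rfl fun u _ => ?_
  rw [Fin.prod_univ_add, Fin.prod_univ_add]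
  simp_rw [hNe, hNf, hNh]
  simp only [d, Fin.addCases_left, Fin.addCases_right, card_boundedPartitions_one,
    card_boundedPartitions_zero, Finset.prod_const_one, mul_one]
  split_ifs with hu
  · rfl
  -- Tuples excluded by the filter contribute zero: a number has no partition into more positive
  -- parts than its value.
  · rw [not_and_or] at hu
    push Not at hu
    rcases hu with ⟨i, hi⟩ | ⟨i, hi⟩
    · refine mul_eq_zero_of_left (Finset.prod_eq_zero (Finset.mem_univ i) ?_) _
      exact partitionCount_eq_zero hi
    · refine mul_eq_zero_of_right _ (Finset.prod_eq_zero (Finset.mem_univ i) ?_)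
      exact partitionCount_eq_zero hi

end RCLattice

theorem theorem4p1 {B : Type*} [Lattice B] [Finite B] (k r n : ℕ)
    (hB : RCLattice.IsBasicBlock B) (hRC : RCLattice.IsRC B)
    (hk : RCLattice.nullity B = k) (hr : (RCLattice.Red B).ncard = r)
    (hr2 : 2 ≤ r) (hrk : r ≤ 2 * k) (hn : Nat.card B ≤ n) :
    Nonempty (RCLattice.AdjunctRep B k) ∧
    ∀ (R : RCLattice.AdjunctRep B k) (m p : ℕ)
      (e : Fin m ≃ R.innerPairs) (f : Fin p ≃ R.outerPairs),
      k = (∑ j, R.mult (e j)) + (∑ j, R.mult (f j)) ∧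
      Nat.card B = r + m + k ∧
      ∃ l : ℕ, r = m + 1 + l ∧
        RCLattice.numBlocks n B k r =
          ∑ u ∈ (Finset.Nat.antidiagonalTuple (m + p + l) (n - r)).filter
              (fun u : Fin (m + p + l) → ℕ =>
                (∀ i : Fin m, R.mult (e i) + 1 ≤ u (Fin.castAdd l (Fin.castAdd p i))) ∧
                (∀ i : Fin p, R.mult (f i) ≤ u (Fin.castAdd l (Fin.natAdd m i)))),
            (∏ i : Fin m, RCLattice.partitionCount
                (u (Fin.castAdd l (Fin.castAdd p i))) (R.mult (e i) + 1)) *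
            (∏ i : Fin p, RCLattice.partitionCount
                (u (Fin.castAdd l (Fin.natAdd m i))) (R.mult (f i))) := by
  obtain ⟨r, rfl⟩ : ∃ r', r = r' + 1 := ⟨r - 1, by omega⟩
  have hcard : r + 1 ≤ Nat.card B := by
    rw [← hr, ← Set.ncard_univ]
    exact Set.ncard_le_ncard (Set.subset_univ _)
  have hne : Nat.card B ≠ 1 := by omega
  obtain ⟨E, G, ⟨Λ⟩⟩ := (hB.isBlock hne).exists_labeling hRC hr
  have hbasic := hB.isBasicRetract hne Λ
  have hE := Λ.finite_strands
  have := Fintype.ofFinite E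
  -- The nullity is the number of strands minus the number of vertices plus one, and there are `r +
  -- 1` vertices.
  have hEcard : Nat.card E = k + r := by
    have h := Λ.nullity_eq
    rw [hk] at h
    simp only [Nat.card_fin] at h
    push_cast at h
    omega
  refine ⟨Λ.nonempty_adjunctRep hEcard, fun R m p e f => ?_⟩
  obtain ⟨h1, h2, l, hl, h3⟩ := RCLattice.count_of_adjunctRep Λ hbasic hk hEcard R e f
  exact ⟨h1, h2, l, hl, h3 n (hcard.trans hn)⟩
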